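/- Let $n\ge 1$, let $\Omega\subset\mathbb R^n$ be a bounded open set with Lipschitz boundary, and let $q\ge 1$. Let $\mathrm{BV}(\Omega)$ be the space of all $u\in L^1(\Omega)$ with finite total variation $$\int_\Omega|Du|:=\sup\Big\{\int_\Omega u\,\mathrm{div}\,g\,dx:\ g\in C^1_c(\Omega)^n,\ |g|\le 1\Big\}<\infty .$$ For $u\in \mathrm{BV}(\Omega)$ let $$\mathscr A(u)=\int_\Omega\sqrt{1+|\nabla u|^2}:=\sup\Big\{\int_\Omega \big(g_0+u\,\mathrm{div}\,g\big)\,dx:\ g_0\in C^1_c(\Omega),\ g\in C^1_c(\Omega)^n,\ g_0^2+|g|^2\le 1\Big\},$$ and let the value of $u$ at $x\in\partial\Omega$ be its trace, that is, for $\mathscr H^{n-1}$-almost every $x\in\partial\Omega$, the number $u(x)$ with $\lim_{r\downarrow0}r^{-n}\int_{B_r(x)\cap\Omega}|u(y)-u(x)|\,dy=0$. Let $G_\pm:\Omega\times\mathbb R\to\mathbb R$ be such that $x\mapsto G_\pm(x,v(x))$ is measurable for every $v\in L^q(\Omega)\cap\mathrm{BV}(\Omega)$ (for example, Carathéodory functions),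 and suppose that $|G_\pm(x,s)|\le C_1(x)|s|^q+C_2(x)$ for almost every $x\in\Omega$ and all $s\in\mathbb R$, where $C_1\in L^\infty(\Omega)$ and $C_2\in L^1(\Omega)$. For $v\in L^q(\Omega)\cap \mathrm{BV}(\Omega)$ put $$\mathscr F_\pm(v)=\mathscr A(v)+\int_{\partial\Omega}|v|\,d\mathscr H^{n-1}+\int_\Omega G_\pm(x,v(x))\,dx,\qquad \Delta(v)=\int_\Omega \big(G_+(x,v(x))-G_-(x,v(x))\big)\,dx .$$ Let $K_+,K_-\subset L^q(\Omega)\cap \mathrm{BV}(\Omega)$, and let $u_+\in K_+$ and $u_-\in K_-$ be global minimizers of $\mathscr F_+$ on $K_+$ and of $\mathscr F_-$ on $K_-$, respectively. If $$\min(u_+,u_-)\in K_-\quad\text{and}\quad \max(u_+,u_-)\in K_+,$$ then $$\Delta(\max(u_+,u_-))-\Delta(u_+)\ge 0 .$$ -/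

import Mathlib

open MeasureTheory Set Filter Topology
open scoped ENNReal NNReal

namespace BVArea

noncomputable section

/-- The divergence `∑ i, ∂ᵢ gᵢ` of a vector field on `ℝⁿ`. -/
def div {n : ℕ} (g : EuclideanSpace ℝ (Fin n) → EuclideanSpace ℝ (Fin n))
    (x : EuclideanSpace ℝ (Fin n)) : ℝ :=
  ∑ i, (fderiv ℝ g x (EuclideanSpace.single i 1)) i

/-- `C¹` maps with compact support contained in `Ω`, extended by zero to the whole space. -/
def IsTest {n : ℕ} {F : Type*} [NormedAddCommGroup F] [NormedSpace ℝ F]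
    (Ω : Set (EuclideanSpace ℝ (Fin n))) (g : EuclideanSpace ℝ (Fin n) → F) : Prop :=
  ContDiff ℝ 1 g ∧ HasCompactSupport g ∧ tsupport g ⊆ Ω

/-- The total variation `∫_Ω |Du|`, the supremum of `∫_Ω u div g` over `g ∈ C¹_c(Ω)ⁿ` with
`|g| ≤ 1`. (Since `g = 0` is allowed, cutting off negative values by `ENNReal.ofReal` does not
change the supremum.) -/
def totalVariation {n : ℕ} (Ω : Set (EuclideanSpace ℝ (Fin n)))
    (u : EuclideanSpace ℝ (Fin n) → ℝ) : ℝ≥0∞ :=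
  ⨆ (g : EuclideanSpace ℝ (Fin n) → EuclideanSpace ℝ (Fin n))
    (_ : IsTest Ω g) (_ : ∀ x, ‖g x‖ ≤ 1),
    ENNReal.ofReal (∫ x in Ω, u x * div g x)

/-- `u ∈ BV(Ω)`: `u ∈ L¹(Ω)` with finite total variation over `Ω`. -/
def MemBV {n : ℕ} (Ω : Set (EuclideanSpace ℝ (Fin n)))
    (u : EuclideanSpace ℝ (Fin n) → ℝ) : Prop :=
  IntegrableOn u Ω ∧ totalVariation Ω u < ∞

/-- The space `L^q ∩ BV(Ω)`; only the values of the functions on `Ω` matter. -/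
def LqBV {n : ℕ} (q : ℝ) (Ω : Set (EuclideanSpace ℝ (Fin n))) :
    Set (EuclideanSpace ℝ (Fin n) → ℝ) :=
  {u | MemLp u (ENNReal.ofReal q) (volume.restrict Ω) ∧ MemBV Ω u}

/-- The area `𝒜(u) = ∫_Ω √(1 + |∇u|²)` of the graph of `u`, the supremum of
`∫_Ω (g₀ + u div g)` over `g₀ ∈ C¹_c(Ω)`, `g ∈ C¹_c(Ω)ⁿ` with `g₀² + |g|² ≤ 1`. -/
def area {n : ℕ} (Ω : Set (EuclideanSpace ℝ (Fin n)))
    (u : EuclideanSpace ℝ (Fin n) → ℝ) : ℝ≥0∞ :=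
  ⨆ (g₀ : EuclideanSpace ℝ (Fin n) → ℝ)
    (g : EuclideanSpace ℝ (Fin n) → EuclideanSpace ℝ (Fin n))
    (_ : IsTest Ω g₀) (_ : IsTest Ω g) (_ : ∀ x, g₀ x ^ 2 + ‖g x‖ ^ 2 ≤ 1),
    ENNReal.ofReal (∫ x in Ω, (g₀ x + u x * div g x))

/-- `Ω` has Lipschitz boundary: near each boundary point there is a direction `e` such that `Ω` is
the part lying above the graph of a Lipschitz function of the component orthogonal to `e`. -/
def HasLipschitzBoundary {n : ℕ} (Ω : Set (EuclideanSpace ℝ (Fin n))) : Prop :=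
  ∀ x ∈ frontier Ω, ∃ e : EuclideanSpace ℝ (Fin n), ‖e‖ = 1 ∧
    ∃ (K : ℝ≥0) (γ : EuclideanSpace ℝ (Fin n) → ℝ), LipschitzWith K γ ∧
      ∀ᶠ y in 𝓝 x, (y ∈ Ω ↔ γ (y - inner ℝ e y • e) < inner ℝ e y)

/-- The number `t` is the trace of `u` at the boundary point `x` of `Ω`:
`r⁻ⁿ ∫_{B_r(x) ∩ Ω} |u(y) - t| dy → 0` as `r ↓ 0`. -/
def HasTraceAt {n : ℕ} (Ω : Set (EuclideanSpace ℝ (Fin n)))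
    (u : EuclideanSpace ℝ (Fin n) → ℝ) (x : EuclideanSpace ℝ (Fin n)) (t : ℝ) : Prop :=
  Tendsto (fun r : ℝ => (r ^ n)⁻¹ * ∫ y in Metric.ball x r ∩ Ω, |u y - t|) (𝓝[>] 0) (𝓝 0)

open Classical in
/-- The boundary trace of `u`. For `u ∈ BV(Ω)` and `∂Ω` Lipschitz, the trace exists (and is unique)
at almost every boundary point for the surface measure; at the others the value is set to `0`. -/
def trace {n : ℕ} (Ω : Set (EuclideanSpace ℝ (Fin n)))
    (u : EuclideanSpace ℝ (Fin n) → ℝ) (x : EuclideanSpace ℝ (Fin n)) : ℝ :=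
  if h : ∃ t, HasTraceAt Ω u x t then h.choose else 0

/-- The functional `𝒜(v) + ∫_{∂Ω} |v| dℋⁿ⁻¹ + ∫_Ω G(x, v) dx`, where `v` on `∂Ω` is the trace and
`μHE[n - 1]` is the normalized `(n - 1)`-dimensional Hausdorff measure (used for `n ≥ 1`). -/
def energy {n : ℕ} (Ω : Set (EuclideanSpace ℝ (Fin n)))
    (G : EuclideanSpace ℝ (Fin n) → ℝ → ℝ) (v : EuclideanSpace ℝ (Fin n) → ℝ) : ℝ :=
  (area Ω v).toReal + (∫ x in frontier Ω, |trace Ω v x| ∂μHE[n - 1]) + ∫ x in Ω, G x (v x)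

/-- `Δ(v) = ∫_Ω (G₊(x, v) - G₋(x, v)) dx`. -/
def energyGap {n : ℕ} (Ω : Set (EuclideanSpace ℝ (Fin n)))
    (Gp Gm : EuclideanSpace ℝ (Fin n) → ℝ → ℝ) (v : EuclideanSpace ℝ (Fin n) → ℝ) : ℝ :=
  ∫ x in Ω, (Gp x (v x) - Gm x (v x))

/-- `u` is a global minimizer of `J` on the set `K` (and belongs to `K`). -/
def IsMinimizer {X : Type*} (J : X → ℝ) (K : Set X) (u : X) : Prop :=
  u ∈ K ∧ ∀ v ∈ K, J u ≤ J v

end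

end BVArea

/-!
The three parts of the energy are submodular: replacing `u, v` by `max u v, min u v` does not
increase the total area, and changes neither the sum of the boundary integrals nor that of the
lower order terms. Comparing `u₊` with `max u₊ u₋` and `u₋` with `min u₊ u₋` in the two minimality
inequalities therefore leaves exactly the difference of the two lower order functionals.

For the area, mollify `u` and `v` and smooth the maximum, so that the gradients of the smooth
maximum and minimum are complementary convex combinations of the two gradients. Integrating by parts
turns test fields for `max u v` and `min u v` into pointwise convex combinations of each other, and
these are test fields for `u` and `v`.

For the boundary term, the trace has to be shown to exist almost everywhere. Over a Lipschitz graph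
the total variation controls the sum of the essential oscillations on dyadic intervals along almost
every vertical line, so the dyadic averages converge to an integrable function on the base, and
Lebesgue's differentiation theorem on the base gives the trace at almost every point.
-/

namespace BVArea

/-! ### Mollification -/

section Mollification

open scoped Convolution Pointwise

/-- A sequence of bump functions around the origin whose supports shrink to `{0}`. -/
noncomputable def bump (E : Type*) [NormedAddCommGroup E] (k : ℕ) : ContDiffBump (0 : E) where
  rIn := 1 / (2 * ((k : ℝ) + 1))
  rOut := 1 / ((k : ℝ) + 1)
  rIn_pos := by positivity
  rIn_lt_rOut := one_div_lt_one_div_of_lt (by positivity) (by linarith [k.cast_nonneg (α := ℝ)])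

lemma tendsto_bump_rOut {E : Type*} [NormedAddCommGroup E] :
    Tendsto (fun k => (bump E k).rOut) atTop (𝓝 0) :=
  tendsto_one_div_add_atTop_nhds_zero_nat

lemma eventually_closedBall_bump_add_subset {E : Type*} [NormedAddCommGroup E] {K Ω : Set E}
    (hK : IsCompact K) (hΩ : IsOpen Ω) (h : K ⊆ Ω) :
    ∀ᶠ k in atTop, Metric.closedBall 0 (bump E k).rOut + K ⊆ Ω := by
  obtain ⟨δ, hδ, hδΩ⟩ := hK.exists_cthickening_subset_open hΩ h
  filter_upwards [(tendsto_bump_rOut (E := E)).eventually_le_const hδ] with k hk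
  refine subset_trans ?_ hδΩ
  rintro _ ⟨a, ha, b, hb, rfl⟩
  refine Metric.mem_cthickening_of_dist_le _ b _ _ hb ?_
  rw [mem_closedBall_zero_iff] at ha
  simpa using ha.trans hk

variable {E : Type*} [NormedAddCommGroup E] [InnerProductSpace ℝ E] [FiniteDimensional ℝ E]
  [MeasurableSpace E] [BorelSpace E]
  {F : Type*} [NormedAddCommGroup F] [NormedSpace ℝ F]
  {G : Type*} [NormedAddCommGroup G] [NormedSpace ℝ G]

/-- The mollification of `f` by the normalized bump function `φ`, that is, their convolution. -/
noncomputable def mollify (φ : ContDiffBump (0 : E)) (f : E → F) : E → F :=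
  φ.normed volume ⋆[ContinuousLinearMap.lsmul ℝ ℝ, volume] f

variable (φ : ContDiffBump (0 : E))

lemma mollify_apply (f : E → F) (x : E) :
    mollify φ f x = ∫ t, φ.normed volume t • f (x - t) := rfl

lemma integrable_normed_smul {f : E → F} (hf : LocallyIntegrable f) (x : E) :
    Integrable fun t => φ.normed volume t • f (x - t) :=
  φ.hasCompactSupport_normed.convolutionExists_left (ContinuousLinearMap.lsmul ℝ ℝ)
    φ.continuous_normed hf x

lemma mollify_sub {f g : E → F} (hf : LocallyIntegrable f) (hg : LocallyIntegrable g) :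
    mollify φ (f - g) = mollify φ f - mollify φ g := by
  ext x
  simp only [Pi.sub_apply, mollify_apply, smul_sub]
  exact integral_sub (integrable_normed_smul φ hf x) (integrable_normed_smul φ hg x)

lemma mollify_nonneg {f : E → ℝ} (hf : 0 ≤ f) : 0 ≤ mollify φ f := fun _ =>
  integral_nonneg fun t => mul_nonneg (φ.nonneg_normed t) (hf _)

lemma norm_mollify_le [CompleteSpace F] {f : E → F} (hf : AEStronglyMeasurable f volume) {C : ℝ}
    (hC : ∀ x, ‖f x‖ ≤ C) (x : E) : ‖mollify φ f x‖ ≤ C := by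
  have := dist_convolution_le (μ := volume) (f := φ.normed volume) (g := f) (x₀ := x)
    (R := φ.rOut) (z₀ := 0) ((norm_nonneg _).trans (hC 0)) φ.support_normed_eq.subset
    φ.nonneg_normed φ.integral_normed hf (fun y _ => by simpa using hC y)
  simpa only [mollify, dist_zero_right] using this

lemma contDiff_mollify [CompleteSpace F] {f : E → F} (hf : LocallyIntegrable f) {m : ℕ∞} :
    ContDiff ℝ m (mollify φ f) :=
  φ.hasCompactSupport_normed.contDiff_convolution_left _ φ.contDiff_normed hf

lemma integrable_mollify {f : E → F} (hf : Integrable f) : Integrable (mollify φ f) :=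
  φ.integrable_normed.integrable_convolution _ hf

lemma integral_mollify [CompleteSpace F] {f : E → F} (hf : Integrable f) :
    ∫ x, mollify φ f x = ∫ x, f x := by
  unfold mollify
  rw [integral_convolution _ φ.integrable_normed hf, φ.integral_normed]
  simp

lemma clm_mollify [CompleteSpace F] [CompleteSpace G] (L : F →L[ℝ] G) {f : E → F}
    (hf : LocallyIntegrable f) (x : E) :
    L (mollify φ f x) = mollify φ (fun y => L (f y)) x := by
  simp only [mollify_apply, ← L.integral_comp_comm (integrable_normed_smul φ hf x), map_smul]

lemma fderiv_mollify [CompleteSpace F] {f : E → F} (hf : ContDiff ℝ 1 f)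
    (hc : HasCompactSupport f) (x v : E) :
    fderiv ℝ (mollify φ f) x v = mollify φ (fun y => fderiv ℝ f y v) x := by
  have h := hc.hasFDerivAt_convolution_right (μ := volume) (ContinuousLinearMap.lsmul ℝ ℝ)
    (φ.integrable_normed (μ := volume)).locallyIntegrable hf x
  rw [mollify, h.fderiv, convolution_precompR_apply _ φ.integrable_normed.locallyIntegrable
    (hc.fderiv ℝ) (hf.continuous_fderiv one_ne_zero)]
  rfl

lemma tsupport_mollify_subset {f : E → F} (hc : HasCompactSupport f) :
    tsupport (mollify φ f) ⊆ Metric.closedBall 0 φ.rOut + tsupport f := by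
  refine closure_minimal ?_ ((isCompact_closedBall _ _).add hc.isCompact).isClosed
  refine (support_convolution_subset _).trans (add_subset_add ?_ subset_closure)
  rw [φ.support_normed_eq]
  exact Metric.ball_subset_closedBall

lemma integral_mollify_mul {U f : E → ℝ} (hU : Integrable U) (hf : Continuous f)
    (hc : HasCompactSupport f) :
    ∫ x, mollify φ U x * f x = ∫ x, U x * mollify φ f x := by
  obtain ⟨C, hC⟩ := hc.exists_bound_of_continuous hf
  calc ∫ x, mollify φ U x * f x
      = ∫ x, ∫ t, φ.normed volume t * U (x - t) * f x := by
        simp only [mollify_apply, smul_eq_mul, integral_mul_const]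
    _ = ∫ t, ∫ x, φ.normed volume t * U (x - t) * f x := by
        refine integral_integral_swap (Integrable.mul_bdd (c := C) ?_
          (hf.comp continuous_fst).aestronglyMeasurable (Eventually.of_forall fun p => hC _))
        exact φ.integrable_normed.convolution_integrand (ContinuousLinearMap.lsmul ℝ ℝ) hU
    _ = ∫ t, ∫ x, φ.normed volume t * U x * f (x + t) := by
        congr 1 with t
        rw [← integral_add_right_eq_self _ t]
        simp only [add_sub_cancel_right]
    _ = ∫ x, ∫ t, φ.normed volume t * U x * f (x + t) :=
        integral_integral_swap (Integrable.mul_bdd (c := C) (φ.integrable_normed.mul_prod hU)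
          (hf.comp (continuous_snd.add continuous_fst)).aestronglyMeasurable
          (Eventually.of_forall fun p => hC _))
    _ = ∫ x, U x * mollify φ f x := by
        congr 1 with x
        rw [mollify_apply, ← integral_neg_eq_self, ← integral_const_mul]
        simp only [φ.normed_neg, sub_eq_add_neg, smul_eq_mul, mul_comm, mul_left_comm]

lemma ae_tendsto_mollify [CompleteSpace F] {f : E → F} (hf : LocallyIntegrable f) :
    ∀ᵐ x, Tendsto (fun k => mollify (bump E k) f x) atTop (𝓝 (f x)) := by
  refine ContDiffBump.ae_convolution_tendsto_right_of_locallyIntegrable (K := 2)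
    tendsto_bump_rOut (Eventually.of_forall fun k => ?_) hf
  simp only [bump]
  apply le_of_eq
  field_simp

/-- Scheffé's lemma. -/
lemma tendsto_integral_abs_sub_of_tendsto_integral {α : Type*} [MeasurableSpace α]
    {μ : Measure α} {f : ℕ → α → ℝ} {g : α → ℝ} (hf : ∀ k, Integrable (f k) μ)
    (hg : Integrable g μ) (hf0 : ∀ k x, 0 ≤ f k x)
    (hlim : ∀ᵐ x ∂μ, Tendsto (fun k => f k x) atTop (𝓝 (g x)))
    (hint : Tendsto (fun k => ∫ x, f k x ∂μ) atTop (𝓝 (∫ x, g x ∂μ))) :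
    Tendsto (fun k => ∫ x, |f k x - g x| ∂μ) atTop (𝓝 0) := by
  have habs : ∀ a : ℝ, |a| = 2 * max (-a) 0 + a := fun a => by
    rcases le_total a 0 with h | h
    · rw [abs_of_nonpos h, max_eq_left (neg_nonneg.2 h)]; ring
    · rw [abs_of_nonneg h, max_eq_right (neg_nonpos.2 h)]; ring
  have hd : ∀ k, Integrable (fun x => f k x - g x) μ := fun k => (hf k).sub hg
  have hsplit : ∀ k, ∫ x, |f k x - g x| ∂μ
      = 2 * ∫ x, max (-(f k x - g x)) 0 ∂μ + (∫ x, f k x ∂μ - ∫ x, g x ∂μ) := fun k => by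
    simp only [habs]
    have hpos : Integrable (fun x => max (-(f k x - g x)) 0) μ := (hd k).neg.pos_part
    rw [integral_add (hpos.const_mul 2) (hd k), integral_const_mul, integral_sub (hf k) hg]
  have hneg : Tendsto (fun k => ∫ x, max (-(f k x - g x)) 0 ∂μ) atTop (𝓝 (∫ _, (0 : ℝ) ∂μ)) := by
    refine tendsto_integral_of_dominated_convergence (fun x => |g x|)
      (fun k => (hd k).neg.pos_part.aestronglyMeasurable) hg.abs
      (fun k => Eventually.of_forall fun x => ?_) ?_
    · rw [Real.norm_of_nonneg (le_max_right _ _)]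
      exact max_le (by linarith [hf0 k x, le_abs_self (g x)]) (abs_nonneg _)
    · filter_upwards [hlim] with x hx
      simpa using (hx.sub_const (g x)).neg.max (tendsto_const_nhds (x := (0 : ℝ)))
  simpa [hsplit] using (hneg.const_mul 2).add (hint.sub_const (∫ x, g x ∂μ))

lemma tendsto_integral_abs_mollify_sub {U : E → ℝ} (hU : Integrable U) :
    Tendsto (fun k => ∫ x, |mollify (bump E k) U x - U x|) atTop (𝓝 0) := by
  have of_nonneg : ∀ f : E → ℝ, Integrable f → 0 ≤ f →
      Tendsto (fun k => ∫ x, |mollify (bump E k) f x - f x|) atTop (𝓝 0) := fun f hf hf0 =>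
    tendsto_integral_abs_sub_of_tendsto_integral (fun k => integrable_mollify _ hf) hf
      (fun k => mollify_nonneg _ hf0) (ae_tendsto_mollify hf.locallyIntegrable)
      (by simp only [integral_mollify _ hf, tendsto_const_nhds])
  have hP : Integrable fun x => max (U x) 0 := hU.pos_part
  have hN : Integrable fun x => max (-U x) 0 := hU.neg_part
  have hsum := (of_nonneg _ hP fun x => le_max_right _ _).add
    (of_nonneg _ hN fun x => le_max_right _ _)
  have hd : ∀ f : E → ℝ, Integrable f → ∀ k, Integrable fun x => |mollify (bump E k) f x - f x| :=
    fun f hf k => ((integrable_mollify _ hf).sub hf).abs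
  have hU_eq : U = (fun x => max (U x) 0) - fun x => max (-U x) 0 :=
    funext fun x => (max_zero_sub_max_neg_zero_eq_self (U x)).symm
  rw [add_zero] at hsum
  refine squeeze_zero (fun k => integral_nonneg fun x => abs_nonneg _) (fun k => ?_) hsum
  rw [← integral_add (hd _ hP k) (hd _ hN k)]
  refine integral_mono (hd U hU k) ((hd _ hP k).add (hd _ hN k)) fun x => ?_
  have hmoll := congrFun (mollify_sub (bump E k) hP.locallyIntegrable hN.locallyIntegrable) x
  rw [← hU_eq, Pi.sub_apply] at hmoll
  have hUx := congrFun hU_eq x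
  rw [Pi.sub_apply] at hUx
  calc |mollify (bump E k) U x - U x|
      = |(mollify (bump E k) (fun x => max (U x) 0) x - max (U x) 0)
          - (mollify (bump E k) (fun x => max (-U x) 0) x - max (-U x) 0)| := by
        congr 1
        linarith
    _ ≤ _ := abs_sub _ _

end Mollification

/-! ### Test fields -/

section TestFields

open scoped Pointwise

variable {n : ℕ} {F : Type*} [NormedAddCommGroup F] [NormedSpace ℝ F]

local notation "𝔼" => EuclideanSpace ℝ (Fin n)

variable {K Ω : Set (EuclideanSpace ℝ (Fin n))} {u v : EuclideanSpace ℝ (Fin n) → ℝ}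
  {f k : EuclideanSpace ℝ (Fin n) → F} {g h : EuclideanSpace ℝ (Fin n) → EuclideanSpace ℝ (Fin n)}
  {g₀ h₀ s W : EuclideanSpace ℝ (Fin n) → ℝ}

lemma isTest_zero : IsTest Ω (0 : 𝔼 → F) :=
  ⟨contDiff_const, HasCompactSupport.zero, by simp⟩

lemma IsTest.mono (hf : IsTest K f) (hK : K ⊆ Ω) : IsTest Ω f :=
  ⟨hf.1, hf.2.1, hf.2.2.trans hK⟩

lemma IsTest.add (hf : IsTest Ω f) (hk : IsTest Ω k) : IsTest Ω fun x => f x + k x :=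
  ⟨hf.1.add hk.1, hf.2.1.add hk.2.1, (tsupport_add f k).trans (union_subset hf.2.2 hk.2.2)⟩

lemma IsTest.smul (hs : ContDiff ℝ 1 s) (hf : IsTest Ω f) : IsTest Ω fun x => s x • f x :=
  ⟨hs.smul hf.1, hf.2.1.smul_left (f := s), (tsupport_smul_subset_right s f).trans hf.2.2⟩

lemma IsTest.integrable (hf : IsTest Ω f) : Integrable f :=
  hf.1.continuous.integrable_of_hasCompactSupport hf.2.1

lemma IsTest.eq_zero_of_notMem (hf : IsTest Ω f) {x : 𝔼} (hx : x ∉ Ω) : f x = 0 :=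
  image_eq_zero_of_notMem_tsupport fun hx' => hx (hf.2.2 hx')

lemma isTest_mollify [CompleteSpace F] (hf : IsTest K f) {φ : ContDiffBump (0 : 𝔼)}
    (hφ : Metric.closedBall 0 φ.rOut + K ⊆ Ω) : IsTest Ω (mollify φ f) := by
  have hs := tsupport_mollify_subset φ hf.2.1
  exact ⟨contDiff_mollify φ hf.1.continuous.locallyIntegrable,
    ((isCompact_closedBall _ _).add hf.2.1.isCompact).of_isClosed_subset (isClosed_tsupport _) hs,
    hs.trans ((add_subset_add_left hf.2.2).trans hφ)⟩

lemma continuous_div (hg : ContDiff ℝ 1 g) : Continuous (div g) := by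
  unfold div
  have := hg.continuous_fderiv one_ne_zero
  fun_prop

lemma div_zero (x : 𝔼) : div (0 : 𝔼 → 𝔼) x = 0 := by
  simp [div]

lemma tsupport_div_subset (g : 𝔼 → 𝔼) : tsupport (div g) ⊆ tsupport g := by
  refine (closure_mono fun x hx => ?_).trans (tsupport_fderiv_subset ℝ (f := g))
  contrapose! hx
  simp only [Function.mem_support, not_not] at hx ⊢
  simp [div, hx]

lemma IsTest.hasCompactSupport_div (hg : IsTest Ω g) : HasCompactSupport (div g) :=
  hg.2.1.of_isClosed_subset (isClosed_tsupport _) (tsupport_div_subset g)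

lemma IsTest.div_eq_zero_of_notMem (hg : IsTest Ω g) {x : 𝔼} (hx : x ∉ Ω) : div g x = 0 :=
  image_eq_zero_of_notMem_tsupport fun hx' => hx (hg.2.2 (tsupport_div_subset g hx'))

lemma IsTest.exists_norm_div_le (hg : IsTest Ω g) : ∃ C, ∀ x, ‖div g x‖ ≤ C :=
  hg.hasCompactSupport_div.exists_bound_of_continuous (continuous_div hg.1)

lemma IsTest.integrable_mul_div {μ : Measure 𝔼} (hg : IsTest Ω g) (hu : Integrable u μ) :
    Integrable (fun x => u x * div g x) μ := by
  obtain ⟨C, hC⟩ := hg.exists_norm_div_le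
  exact hu.mul_bdd (c := C) (continuous_div hg.1).aestronglyMeasurable (Eventually.of_forall hC)

lemma IsTest.div_mollify (hg : IsTest Ω g) (φ : ContDiffBump (0 : 𝔼)) (x : 𝔼) :
    div (mollify φ g) x = mollify φ (div g) x := by
  have hcont := hg.1.continuous_fderiv one_ne_zero
  have hpartial : ∀ i, LocallyIntegrable
      fun y => (fderiv ℝ g y (EuclideanSpace.single i 1)) i := fun i =>
    Continuous.locallyIntegrable (by fun_prop)
  have hcomp : ∀ i, (fderiv ℝ (mollify φ g) x (EuclideanSpace.single i 1)) i
      = mollify φ (fun y => (fderiv ℝ g y (EuclideanSpace.single i 1)) i) x := fun i => by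
    rw [fderiv_mollify φ hg.1 hg.2.1]
    exact clm_mollify φ (EuclideanSpace.proj i : 𝔼 →L[ℝ] ℝ)
      (Continuous.locallyIntegrable (by fun_prop)) x
  unfold div
  simp only [hcomp, mollify_apply]
  rw [← integral_finsetSum _ fun i _ => integrable_normed_smul φ (hpartial i) x]
  simp only [Finset.smul_sum]

lemma IsTest.integral_mollify_indicator_mul_div (hg : IsTest K g) (φ : ContDiffBump (0 : 𝔼))
    (hΩ : MeasurableSet Ω) (hu : IntegrableOn u Ω) :
    ∫ x, mollify φ (Ω.indicator u) x * div g x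
      = ∫ x in Ω, u x * div (mollify φ g) x := by
  rw [integral_mollify_mul φ ((integrable_indicator_iff hΩ).2 hu) (continuous_div hg.1)
    hg.hasCompactSupport_div, ← integral_indicator hΩ]
  simp only [indicator_mul_left, hg.div_mollify]

lemma fderiv_apply_eq_sum (x y : 𝔼) :
    fderiv ℝ W x y = ∑ i, fderiv ℝ W x (EuclideanSpace.single i 1) * y i := by
  conv_lhs => rw [← (EuclideanSpace.basisFun (Fin n) ℝ).sum_repr y]
  simp [map_sum, mul_comm]

lemma div_eq_sum_fderiv (hg : ContDiff ℝ 1 g) (x : 𝔼) :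
    div g x = ∑ i, fderiv ℝ (fun y => g y i) x (EuclideanSpace.single i 1) := by
  refine Finset.sum_congr rfl fun i _ => ?_
  have hcomp := ((EuclideanSpace.proj i : 𝔼 →L[ℝ] ℝ).hasFDerivAt.comp x
    (hg.differentiable one_ne_zero x).hasFDerivAt).fderiv
  have hfun : (fun y => g y i) = (EuclideanSpace.proj i : 𝔼 →L[ℝ] ℝ) ∘ g := rfl
  rw [hfun, hcomp]
  simp

lemma IsTest.integrable_fderiv_apply (hg : IsTest Ω g) (hW : ContDiff ℝ 1 W) :
    Integrable fun x => fderiv ℝ W x (g x) := by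
  have := hW.continuous_fderiv one_ne_zero
  have hg' := hg.1.continuous
  refine Continuous.integrable_of_hasCompactSupport (by fun_prop) (hg.2.1.mono fun x hx => ?_)
  contrapose! hx
  simp only [Function.mem_support, not_not] at hx ⊢
  rw [hx, map_zero]

lemma IsTest.integrable_sub_fderiv_apply (hg₀ : IsTest Ω g₀) (hg : IsTest Ω g)
    (hW : ContDiff ℝ 1 W) : Integrable fun x => g₀ x - fderiv ℝ W x (g x) :=
  hg₀.integrable.sub (hg.integrable_fderiv_apply hW)

lemma IsTest.integral_mul_div_eq (hg : IsTest Ω g) (hW : ContDiff ℝ 1 W) :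
    ∫ x, W x * div g x = -∫ x, fderiv ℝ W x (g x) := by
  have hg1 := hg.1
  have := hW.continuous_fderiv one_ne_zero
  have hgi : ∀ i, ContDiff ℝ 1 fun x => g x i := fun i => by fun_prop
  have hgc : ∀ i, HasCompactSupport fun x => g x i := fun i =>
    hg.2.1.comp_left (g := fun z : 𝔼 => z i) (by simp)
  have hI₁ : ∀ i, Integrable fun x => fderiv ℝ W x (EuclideanSpace.single i 1) * g x i :=
    fun i => Continuous.integrable_of_hasCompactSupport (by fun_prop) (hgc i).mul_left
  have hI₂ : ∀ i, Integrable fun x =>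
      W x * fderiv ℝ (fun y => g y i) x (EuclideanSpace.single i 1) := fun i => by
    have := (hgi i).continuous_fderiv one_ne_zero
    exact Continuous.integrable_of_hasCompactSupport (by fun_prop)
      ((hgc i).fderiv_apply ℝ _).mul_left
  have hI₃ : ∀ i, Integrable fun x => W x * g x i := fun i =>
    Continuous.integrable_of_hasCompactSupport (by fun_prop) (hgc i).mul_left
  simp only [div_eq_sum_fderiv hg.1, fderiv_apply_eq_sum (W := W) _ (g _), Finset.mul_sum]
  rw [integral_finsetSum _ fun i _ => hI₁ i, integral_finsetSum _ fun i _ => hI₂ i,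
    ← Finset.sum_neg_distrib]
  exact Finset.sum_congr rfl fun i _ => integral_mul_fderiv_eq_neg_fderiv_mul_of_integrable
    (hI₁ i) (hI₂ i) (hI₃ i) (fun x _ => hW.differentiable one_ne_zero x)
    (fun x _ => (hgi i).differentiable one_ne_zero x)

lemma IsTest.integral_add_mul_div_eq (hg₀ : IsTest Ω g₀) (hg : IsTest Ω g)
    (hW : ContDiff ℝ 1 W) :
    ∫ x, (g₀ x + W x * div g x) = ∫ x, (g₀ x - fderiv ℝ W x (g x)) := by
  have hi : Integrable fun x => W x * div g x :=
    (hW.continuous.mul (continuous_div hg.1)).integrable_of_hasCompactSupport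
      hg.hasCompactSupport_div.mul_left
  rw [integral_add hg₀.integrable hi,
    integral_sub hg₀.integrable (hg.integrable_fderiv_apply hW), hg.integral_mul_div_eq hW,
    sub_eq_add_neg]

lemma sq_add_norm_sq_le_one_iff {E : Type*} [NormedAddCommGroup E] {a : ℝ} {x : E} :
    a ^ 2 + ‖x‖ ^ 2 ≤ 1 ↔ ‖WithLp.toLp 2 (a, x)‖ ≤ 1 := by
  rw [← sq_le_one_iff₀ (norm_nonneg _), WithLp.prod_norm_sq_eq_of_L2, Real.norm_eq_abs, sq_abs,
    WithLp.toLp_fst, WithLp.toLp_snd]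

/-- The pairs `(g₀, g)` of test fields admitted in the supremum that defines `area Ω`. -/
structure IsAreaTest (Ω : Set (EuclideanSpace ℝ (Fin n))) (g₀ : EuclideanSpace ℝ (Fin n) → ℝ)
    (g : EuclideanSpace ℝ (Fin n) → EuclideanSpace ℝ (Fin n)) : Prop where
  isTest_fst : IsTest Ω g₀
  isTest_snd : IsTest Ω g
  sq_add_norm_sq_le_one : ∀ x, g₀ x ^ 2 + ‖g x‖ ^ 2 ≤ 1

lemma isAreaTest_zero : IsAreaTest Ω (0 : 𝔼 → ℝ) (0 : 𝔼 → 𝔼) :=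
  ⟨isTest_zero, isTest_zero, by simp⟩

lemma IsAreaTest.le_one (hg : IsAreaTest Ω g₀ g) (x : 𝔼) : g₀ x ≤ 1 := by
  nlinarith [hg.sq_add_norm_sq_le_one x, sq_nonneg ‖g x‖]

lemma IsAreaTest.norm_le_one (hg : IsAreaTest Ω g₀ g) (x : 𝔼) : ‖g x‖ ≤ 1 := by
  nlinarith [hg.sq_add_norm_sq_le_one x, sq_nonneg (g₀ x)]

lemma IsAreaTest.mono (hg : IsAreaTest K g₀ g) (hK : K ⊆ Ω) : IsAreaTest Ω g₀ g :=
  ⟨hg.isTest_fst.mono hK, hg.isTest_snd.mono hK, hg.sq_add_norm_sq_le_one⟩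

lemma IsAreaTest.exists_isCompact (hg : IsAreaTest Ω g₀ g) :
    ∃ K, IsCompact K ∧ K ⊆ Ω ∧ IsAreaTest K g₀ g := by
  obtain ⟨⟨hg₀, hc₀, hs₀⟩, ⟨hg, hc, hs⟩, hle⟩ := hg
  exact ⟨tsupport g₀ ∪ tsupport g, hc₀.isCompact.union hc.isCompact, union_subset hs₀ hs,
    ⟨hg₀, hc₀, subset_union_left⟩, ⟨hg, hc, subset_union_right⟩, hle⟩

lemma IsAreaTest.convexCombo (hg : IsAreaTest Ω g₀ g) (hh : IsAreaTest Ω h₀ h)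
    (hs : ContDiff ℝ 1 s) (hs01 : ∀ x, s x ∈ Icc (0 : ℝ) 1) :
    IsAreaTest Ω (fun x => s x • g₀ x + (1 - s x) • h₀ x)
      fun x => s x • g x + (1 - s x) • h x := by
  have hs' : ContDiff ℝ 1 fun x => 1 - s x := contDiff_const.sub hs
  refine ⟨(hg.isTest_fst.smul hs).add (hh.isTest_fst.smul hs'),
    (hg.isTest_snd.smul hs).add (hh.isTest_snd.smul hs'), fun x => ?_⟩
  have hball := convex_closedBall (0 : WithLp 2 (ℝ × 𝔼)) 1
    (mem_closedBall_zero_iff.2 (sq_add_norm_sq_le_one_iff.1 (hg.sq_add_norm_sq_le_one x)))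
    (mem_closedBall_zero_iff.2 (sq_add_norm_sq_le_one_iff.1 (hh.sq_add_norm_sq_le_one x)))
    (hs01 x).1 (sub_nonneg.2 (hs01 x).2) (add_sub_cancel _ _)
  exact sq_add_norm_sq_le_one_iff.2 (mem_closedBall_zero_iff.1 hball)

lemma isAreaTest_mollify (hg : IsAreaTest K g₀ g) {φ : ContDiffBump (0 : 𝔼)}
    (hφ : Metric.closedBall 0 φ.rOut + K ⊆ Ω) :
    IsAreaTest Ω (mollify φ g₀) (mollify φ g) := by
  refine ⟨isTest_mollify hg.isTest_fst hφ, isTest_mollify hg.isTest_snd hφ, fun x => ?_⟩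
  have hcont : Continuous fun y => WithLp.toLp 2 (g₀ y, g y) :=
    (WithLp.prod_continuous_toLp 2 ℝ 𝔼).comp
      (hg.isTest_fst.1.continuous.prodMk hg.isTest_snd.1.continuous)
  have hle := norm_mollify_le φ hcont.aestronglyMeasurable
    (fun y => sq_add_norm_sq_le_one_iff.1 (hg.sq_add_norm_sq_le_one y)) x
  have hfst : (mollify φ (fun y => WithLp.toLp 2 (g₀ y, g y)) x).fst
      = mollify φ g₀ x :=
    clm_mollify φ (WithLp.fstL 2 ℝ ℝ 𝔼) hcont.locallyIntegrable x
  have hsnd : (mollify φ (fun y => WithLp.toLp 2 (g₀ y, g y)) x).snd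
      = mollify φ g x :=
    clm_mollify φ (WithLp.sndL 2 ℝ ℝ 𝔼) hcont.locallyIntegrable x
  rw [← sq_le_one_iff₀ (norm_nonneg _), WithLp.prod_norm_sq_eq_of_L2, Real.norm_eq_abs,
    sq_abs, hfst, hsnd] at hle
  exact hle

lemma IsAreaTest.setIntegral_eq (hg : IsAreaTest Ω g₀ g) (W : 𝔼 → ℝ) :
    ∫ x in Ω, (g₀ x + W x * div g x) = ∫ x, (g₀ x + W x * div g x) :=
  setIntegral_eq_integral_of_forall_compl_eq_zero fun x hx => by
    rw [hg.isTest_fst.eq_zero_of_notMem hx, hg.isTest_snd.div_eq_zero_of_notMem hx, mul_zero,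
      add_zero]

end TestFields

/-! ### Submodularity of the area -/

section SoftMax

variable {δ : ℝ}

/-- A smooth approximation, at scale `δ`, of the sign function. -/
noncomputable def softSign (δ t : ℝ) : ℝ := t / √(t ^ 2 + δ ^ 2)

/-- A smooth approximation, at scale `δ`, of the indicator function of the positive half-line; it
is the derivative of `softPos δ`. -/
noncomputable def softStep (δ t : ℝ) : ℝ := (1 + softSign δ t) / 2

/-- A smooth approximation, at scale `δ`, of the positive part. -/
noncomputable def softPos (δ t : ℝ) : ℝ := (t + √(t ^ 2 + δ ^ 2)) / 2

/-- A smooth approximation, at scale `δ`, of `max a b`. -/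
noncomputable def softMax (δ a b : ℝ) : ℝ := b + softPos δ (a - b)

/-- A smooth approximation, at scale `δ`, of `min a b`; the sum with `softMax δ a b` is exactly
`a + b`. -/
noncomputable def softMin (δ a b : ℝ) : ℝ := a - softPos δ (a - b)

lemma abs_le_sqrt_sq_add_sq (δ t : ℝ) : |t| ≤ √(t ^ 2 + δ ^ 2) :=
  Real.abs_le_sqrt (le_add_of_nonneg_right (sq_nonneg δ))

lemma sqrt_sq_add_sq_le (hδ : 0 ≤ δ) (t : ℝ) : √(t ^ 2 + δ ^ 2) ≤ |t| + δ :=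
  Real.sqrt_le_iff.2 ⟨by positivity, by nlinarith [sq_abs t, abs_nonneg t]⟩

lemma abs_softSign_le_one (δ t : ℝ) : |softSign δ t| ≤ 1 := by
  rw [softSign, abs_div, abs_of_nonneg (Real.sqrt_nonneg _)]
  exact div_le_one_of_le₀ (abs_le_sqrt_sq_add_sq δ t) (Real.sqrt_nonneg _)

lemma softStep_mem_Icc (δ t : ℝ) : softStep δ t ∈ Icc (0 : ℝ) 1 := by
  have h := abs_le.1 (abs_softSign_le_one δ t)
  constructor <;> · unfold softStep; linarith

lemma abs_sub_le_mul_softSign (hδ : 0 < δ) (t : ℝ) : |t| - δ ≤ t * softSign δ t := by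
  have hsq : √(t ^ 2 + δ ^ 2) ^ 2 = t ^ 2 + δ ^ 2 := Real.sq_sqrt (by positivity)
  have hpos : 0 < √(t ^ 2 + δ ^ 2) := Real.sqrt_pos.2 (by positivity)
  have hδ' : δ ≤ √(t ^ 2 + δ ^ 2) := Real.le_sqrt_of_sq_le (by nlinarith [sq_nonneg t])
  rw [softSign, ← mul_div_assoc, le_div_iff₀ hpos]
  nlinarith [abs_le_sqrt_sq_add_sq δ t]

lemma contDiff_sqrt_sq_add_sq (hδ : 0 < δ) : ContDiff ℝ 1 fun t : ℝ => √(t ^ 2 + δ ^ 2) :=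
  ContDiff.sqrt (by fun_prop) fun t => by positivity

lemma contDiff_softSign (hδ : 0 < δ) : ContDiff ℝ 1 (softSign δ) :=
  contDiff_id.div (contDiff_sqrt_sq_add_sq hδ) fun t => by positivity

lemma contDiff_softStep (hδ : 0 < δ) : ContDiff ℝ 1 (softStep δ) :=
  (contDiff_const.add (contDiff_softSign hδ)).div_const 2

lemma hasDerivAt_softPos (hδ : 0 < δ) (t : ℝ) : HasDerivAt (softPos δ) (softStep δ t) t := by
  have hsq : HasDerivAt (fun t : ℝ => t ^ 2 + δ ^ 2) (2 * t) t := by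
    simpa using (hasDerivAt_pow 2 t).add_const (δ ^ 2)
  have hsqrt := hsq.sqrt (by positivity : t ^ 2 + δ ^ 2 ≠ 0)
  refine (((hasDerivAt_id t).add hsqrt).div_const 2).congr_deriv ?_
  unfold softStep softSign
  field_simp

lemma contDiff_softPos (hδ : 0 < δ) : ContDiff ℝ 1 (softPos δ) :=
  (contDiff_id.add (contDiff_sqrt_sq_add_sq hδ)).div_const 2

lemma abs_softPos_sub_max_le (hδ : 0 ≤ δ) (t : ℝ) : |softPos δ t - max t 0| ≤ δ := by
  have hmax : max t 0 = (t + |t|) / 2 := by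
    rcases le_total t 0 with h | h
    · rw [max_eq_right h, abs_of_nonpos h]; ring
    · rw [max_eq_left h, abs_of_nonneg h]; ring
  have h₁ := abs_le_sqrt_sq_add_sq δ t
  have h₂ := sqrt_sq_add_sq_le hδ t
  rw [hmax, softPos, abs_le]
  constructor <;> linarith

lemma abs_softMax_sub_max_le (hδ : 0 ≤ δ) (a b a' b' : ℝ) :
    |softMax δ a' b' - max a b| ≤ |a' - a| + |b' - b| + δ := by
  have hmax : max a' b' = b' + max (a' - b') 0 := by rw [← max_add_add_left]; simp
  have hsoft : |softMax δ a' b' - max a' b'| ≤ δ := by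
    simpa only [softMax, hmax, add_sub_add_left_eq_sub] using abs_softPos_sub_max_le hδ (a' - b')
  have hlip : |max a' b' - max a b| ≤ |a' - a| + |b' - b| :=
    (abs_max_sub_max_le_max a' b' a b).trans (max_le_add_of_nonneg (abs_nonneg _) (abs_nonneg _))
  linarith [abs_sub_le (softMax δ a' b') (max a' b') (max a b)]

lemma abs_softMin_sub_min_le (hδ : 0 ≤ δ) (a b a' b' : ℝ) :
    |softMin δ a' b' - min a b| ≤ |a' - a| + |b' - b| + δ := by
  have hmin : min a' b' = a' - max (a' - b') 0 := by
    rw [← min_sub_sub_left, sub_sub_cancel, sub_zero, min_comm]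
  have hsoft : |softMin δ a' b' - min a' b'| ≤ δ := by
    rw [softMin, hmin, sub_sub_sub_cancel_left, abs_sub_comm]
    exact abs_softPos_sub_max_le hδ (a' - b')
  have hlip : |min a' b' - min a b| ≤ |a' - a| + |b' - b| :=
    (abs_min_sub_min_le_max a' b' a b).trans (max_le_add_of_nonneg (abs_nonneg _) (abs_nonneg _))
  linarith [abs_sub_le (softMin δ a' b') (min a' b') (min a b)]

section Calculus

variable {E : Type*} [NormedAddCommGroup E] [NormedSpace ℝ E] {U V : E → ℝ}

lemma contDiff_softMax (hδ : 0 < δ) (hU : ContDiff ℝ 1 U) (hV : ContDiff ℝ 1 V) :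
    ContDiff ℝ 1 fun x => softMax δ (U x) (V x) :=
  hV.add ((contDiff_softPos hδ).comp (hU.sub hV))

lemma contDiff_softMin (hδ : 0 < δ) (hU : ContDiff ℝ 1 U) (hV : ContDiff ℝ 1 V) :
    ContDiff ℝ 1 fun x => softMin δ (U x) (V x) :=
  hU.sub ((contDiff_softPos hδ).comp (hU.sub hV))

/-- The complementary convex combinations of the derivatives of `U` and `V` are transposed to the
directions `y` and `z`, which will be the values of two test fields. -/
lemma fderiv_softMax_add_fderiv_softMin (hδ : 0 < δ) {x : E} (hU : DifferentiableAt ℝ U x)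
    (hV : DifferentiableAt ℝ V x) (y z : E) {s : ℝ} (hs : s = softStep δ (U x - V x)) :
    fderiv ℝ (fun x => softMax δ (U x) (V x)) x y + fderiv ℝ (fun x => softMin δ (U x) (V x)) x z
      = fderiv ℝ U x (s • y + (1 - s) • z) + fderiv ℝ V x (s • z + (1 - s) • y) := by
  have hpos : HasFDerivAt (fun x => softPos δ (U x - V x)) (s • (fderiv ℝ U x - fderiv ℝ V x)) x :=
    hs ▸ (hasDerivAt_softPos hδ (U x - V x)).comp_hasFDerivAt (f := fun x => U x - V x) x
      (hU.hasFDerivAt.sub hV.hasFDerivAt)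
  have hmax : fderiv ℝ (fun x => softMax δ (U x) (V x)) x
      = fderiv ℝ V x + s • (fderiv ℝ U x - fderiv ℝ V x) := (hV.hasFDerivAt.add hpos).fderiv
  have hmin : fderiv ℝ (fun x => softMin δ (U x) (V x)) x
      = fderiv ℝ U x - s • (fderiv ℝ U x - fderiv ℝ V x) := (hU.hasFDerivAt.sub hpos).fderiv
  rw [hmax, hmin]
  simp only [add_apply, sub_apply, smul_apply, map_add, map_smul, smul_eq_mul]
  ring

end Calculus

end SoftMax

section Area

open scoped Pointwise

variable {n : ℕ}

local notation "𝔼" => EuclideanSpace ℝ (Fin n)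

variable {K Ω : Set (EuclideanSpace ℝ (Fin n))} {u v : EuclideanSpace ℝ (Fin n) → ℝ}
  {g h : EuclideanSpace ℝ (Fin n) → EuclideanSpace ℝ (Fin n)}
  {g₀ h₀ : EuclideanSpace ℝ (Fin n) → ℝ}

lemma ofReal_integral_le_totalVariation (hg : IsTest Ω g) (hg1 : ∀ x, ‖g x‖ ≤ 1) :
    ENNReal.ofReal (∫ x in Ω, u x * div g x) ≤ totalVariation Ω u :=
  le_iSup_of_le g (le_iSup_of_le hg (le_iSup_of_le hg1 le_rfl))

lemma ofReal_integral_le_area (hg : IsAreaTest Ω g₀ g) :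
    ENNReal.ofReal (∫ x in Ω, (g₀ x + u x * div g x)) ≤ area Ω u :=
  le_iSup_of_le g₀ (le_iSup_of_le g (le_iSup_of_le hg.1 (le_iSup_of_le hg.2
    (le_iSup_of_le hg.3 le_rfl))))

lemma integral_le_toReal_area (hA : area Ω u ≠ ∞) (hg : IsAreaTest Ω g₀ g) :
    ∫ x in Ω, (g₀ x + u x * div g x) ≤ (area Ω u).toReal :=
  (ENNReal.ofReal_le_iff_le_toReal hA).1 (ofReal_integral_le_area hg)

lemma area_le {c : ℝ≥0∞} (hc : ∀ g₀ g, IsAreaTest Ω g₀ g →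
    ENNReal.ofReal (∫ x in Ω, (g₀ x + u x * div g x)) ≤ c) : area Ω u ≤ c :=
  iSup_le fun g₀ => iSup_le fun g => iSup_le fun hg₀ => iSup_le fun hg => iSup_le fun hh =>
    hc g₀ g ⟨hg₀, hg, hh⟩

lemma area_add_area_le_ofReal {c : ℝ}
    (hc : ∀ g₀ g h₀ h, IsAreaTest Ω g₀ g → IsAreaTest Ω h₀ h →
      (∫ x in Ω, (g₀ x + u x * div g x)) + ∫ x in Ω, (h₀ x + v x * div h x) ≤ c) :
    area Ω u + area Ω v ≤ ENNReal.ofReal c := by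
  have hzero : ∀ w : 𝔼 → ℝ, ∫ x in Ω, ((0 : 𝔼 → ℝ) x + w x * div (0 : 𝔼 → 𝔼) x) = 0 := fun w => by
    simp [div_zero]
  have hv : ∀ g₀ g, IsAreaTest Ω g₀ g →
      area Ω v ≤ ENNReal.ofReal (c - ∫ x in Ω, (g₀ x + u x * div g x)) := fun g₀ g hg =>
    area_le fun h₀ h hh => ENNReal.ofReal_le_ofReal (by linarith [hc g₀ g h₀ h hg hh])
  have hv_top : area Ω v ≠ ∞ := ne_top_of_le_ne_top ENNReal.ofReal_ne_top (hv _ _ isAreaTest_zero)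
  have hc' : ∀ g₀ g, IsAreaTest Ω g₀ g →
      ∫ x in Ω, (g₀ x + u x * div g x) ≤ c - (area Ω v).toReal := fun g₀ g hg => by
    have hnonneg : 0 ≤ c - ∫ x in Ω, (g₀ x + u x * div g x) := by
      linarith [hc g₀ g 0 0 hg isAreaTest_zero, hzero v]
    linarith [ENNReal.toReal_le_of_le_ofReal hnonneg (hv g₀ g hg)]
  have hc0 : 0 ≤ c - (area Ω v).toReal := (hzero u).symm.le.trans (hc' 0 0 isAreaTest_zero)
  calc area Ω u + area Ω v
      ≤ ENNReal.ofReal (c - (area Ω v).toReal) + ENNReal.ofReal (area Ω v).toReal :=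
        add_le_add (area_le fun g₀ g hg => ENNReal.ofReal_le_ofReal (hc' g₀ g hg))
          (ENNReal.ofReal_toReal hv_top).symm.le
    _ = ENNReal.ofReal c := by
        rw [← ENNReal.ofReal_add hc0 ENNReal.toReal_nonneg, sub_add_cancel]

lemma totalVariation_le_area : totalVariation Ω u ≤ area Ω u :=
  iSup_le fun g => iSup_le fun hg => iSup_le fun hg1 => by
    have hpair : IsAreaTest Ω 0 g :=
      ⟨isTest_zero, hg, fun x => by simpa using hg1 x⟩
    simpa using ofReal_integral_le_area (u := u) hpair

lemma area_lt_top (hΩ : volume Ω < ∞) (hu : MemBV Ω u) : area Ω u < ∞ := by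
  refine lt_of_le_of_lt (area_le fun g₀ g hg => ?_) (ENNReal.add_lt_top.2 ⟨hΩ, hu.2⟩)
  have hi₀ : IntegrableOn g₀ Ω := hg.isTest_fst.integrable.integrableOn
  rw [integral_add hi₀ (hg.isTest_snd.integrable_mul_div hu.1)]
  refine ENNReal.ofReal_add_le.trans (add_le_add (ENNReal.ofReal_le_of_le_toReal ?_)
    (ofReal_integral_le_totalVariation hg.isTest_snd hg.norm_le_one))
  calc ∫ x in Ω, g₀ x ≤ ∫ _ in Ω, (1 : ℝ) :=
        integral_mono hi₀ (integrableOn_const hΩ.ne) hg.le_one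
    _ = (volume Ω).toReal := by simp [Measure.real]

lemma integral_add_mollify_mul_div_le_area (hΩ : MeasurableSet Ω) (hu : IntegrableOn u Ω)
    (hA : area Ω u ≠ ∞) (hg : IsAreaTest K g₀ g) {φ : ContDiffBump (0 : 𝔼)}
    (hφ : Metric.closedBall 0 φ.rOut + K ⊆ Ω) :
    ∫ x, (g₀ x + mollify φ (Ω.indicator u) x * div g x) ≤ (area Ω u).toReal := by
  have hg' := isAreaTest_mollify hg hφ
  have hui : Integrable (Ω.indicator u) := (integrable_indicator_iff hΩ).2 hu
  calc ∫ x, (g₀ x + mollify φ (Ω.indicator u) x * div g x)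
      = (∫ x, mollify φ g₀ x) + ∫ x in Ω, u x * div (mollify φ g) x := by
        rw [integral_add hg.isTest_fst.integrable
          (hg.isTest_snd.integrable_mul_div (integrable_mollify φ hui)),
          integral_mollify φ hg.isTest_fst.integrable,
          hg.isTest_snd.integral_mollify_indicator_mul_div φ hΩ hu]
    _ = ∫ x in Ω, (mollify φ g₀ x + u x * div (mollify φ g) x) := by
        rw [← setIntegral_eq_integral_of_forall_compl_eq_zero
            fun x hx => hg'.isTest_fst.eq_zero_of_notMem hx,
          integral_add hg'.isTest_fst.integrable.integrableOn
            (hg'.isTest_snd.integrable_mul_div hu)]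
    _ ≤ (area Ω u).toReal := integral_le_toReal_area hA hg'

lemma integral_softMax_add_integral_softMin {U V : 𝔼 → ℝ} (hU : ContDiff ℝ 1 U)
    (hV : ContDiff ℝ 1 V) {δ : ℝ} (hδ : 0 < δ) (hg₀ : IsTest Ω g₀) (hg : IsTest Ω g)
    (hh₀ : IsTest Ω h₀) (hh : IsTest Ω h) {s : 𝔼 → ℝ}
    (hs : s = fun x => softStep δ (U x - V x)) :
    (∫ x, (g₀ x + softMax δ (U x) (V x) * div g x))
      + ∫ x, (h₀ x + softMin δ (U x) (V x) * div h x)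
    = (∫ x, ((s x • g₀ x + (1 - s x) • h₀ x)
          + U x * div (fun y => s y • g y + (1 - s y) • h y) x))
      + ∫ x, ((s x • h₀ x + (1 - s x) • g₀ x)
          + V x * div (fun y => s y • h y + (1 - s y) • g y) x) := by
  have hsC : ContDiff ℝ 1 s := hs ▸ (contDiff_softStep hδ).comp (hU.sub hV)
  have hsC' : ContDiff ℝ 1 fun x => 1 - s x := contDiff_const.sub hsC
  have hP₀ := (hg₀.smul hsC).add (hh₀.smul hsC')
  have hQ₀ := (hh₀.smul hsC).add (hg₀.smul hsC')
  have hP := (hg.smul hsC).add (hh.smul hsC')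
  have hQ := (hh.smul hsC).add (hg.smul hsC')
  have hmax := contDiff_softMax hδ hU hV
  have hmin := contDiff_softMin hδ hU hV
  rw [hg₀.integral_add_mul_div_eq hg hmax, hh₀.integral_add_mul_div_eq hh hmin,
    hP₀.integral_add_mul_div_eq hP hU, hQ₀.integral_add_mul_div_eq hQ hV,
    ← integral_add (hg₀.integrable_sub_fderiv_apply hg hmax)
      (hh₀.integrable_sub_fderiv_apply hh hmin),
    ← integral_add (hP₀.integrable_sub_fderiv_apply hP hU)
      (hQ₀.integrable_sub_fderiv_apply hQ hV)]
  congr 1 with x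
  simp only [smul_eq_mul]
  linarith [fderiv_softMax_add_fderiv_softMin hδ (hU.differentiable one_ne_zero x)
    (hV.differentiable one_ne_zero x) (g x) (h x) (congrFun hs x)]

/-- The test fields paired with the mollifications of `u` and `v` are pointwise convex combinations
of `(g₀, g)` and `(h₀, h)`, hence again admissible. -/
lemma integral_softMax_mollify_add_integral_softMin_mollify_le (hΩ : MeasurableSet Ω)
    (hu : IntegrableOn u Ω) (hv : IntegrableOn v Ω) (hAu : area Ω u ≠ ∞) (hAv : area Ω v ≠ ∞)
    (hg : IsAreaTest K g₀ g) (hh : IsAreaTest K h₀ h) {φ : ContDiffBump (0 : 𝔼)}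
    (hφ : Metric.closedBall 0 φ.rOut + K ⊆ Ω) {δ : ℝ} (hδ : 0 < δ) :
    (∫ x, (g₀ x + softMax δ (mollify φ (Ω.indicator u) x) (mollify φ (Ω.indicator v) x) * div g x))
      + ∫ x, (h₀ x + softMin δ (mollify φ (Ω.indicator u) x) (mollify φ (Ω.indicator v) x)
          * div h x)
    ≤ (area Ω u).toReal + (area Ω v).toReal := by
  have hU : ContDiff ℝ 1 (mollify φ (Ω.indicator u)) :=
    contDiff_mollify φ ((integrable_indicator_iff hΩ).2 hu).locallyIntegrable
  have hV : ContDiff ℝ 1 (mollify φ (Ω.indicator v)) :=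
    contDiff_mollify φ ((integrable_indicator_iff hΩ).2 hv).locallyIntegrable
  have hs := (contDiff_softStep hδ).comp (hU.sub hV)
  have hs01 : ∀ x, softStep δ (mollify φ (Ω.indicator u) x - mollify φ (Ω.indicator v) x)
      ∈ Icc (0 : ℝ) 1 := fun x => softStep_mem_Icc δ _
  rw [integral_softMax_add_integral_softMin hU hV hδ hg.isTest_fst hg.isTest_snd hh.isTest_fst
    hh.isTest_snd rfl]
  exact add_le_add
    (integral_add_mollify_mul_div_le_area hΩ hu hAu (hg.convexCombo hh hs hs01) hφ)
    (integral_add_mollify_mul_div_le_area hΩ hv hAv (hh.convexCombo hg hs hs01) hφ)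

lemma IsTest.tendsto_integral_add_mul_div {μ : Measure 𝔼} (hg : IsTest Ω g) {f₀ : 𝔼 → ℝ}
    (hf₀ : Integrable f₀ μ) {M : ℕ → 𝔼 → ℝ} {m : 𝔼 → ℝ} (hM : ∀ k, Integrable (M k) μ)
    (hm : Integrable m μ) (hlim : Tendsto (fun k => ∫ x, |M k x - m x| ∂μ) atTop (𝓝 0)) :
    Tendsto (fun k => ∫ x, (f₀ x + M k x * div g x) ∂μ) atTop
      (𝓝 (∫ x, (f₀ x + m x * div g x) ∂μ)) := by
  obtain ⟨C, hC⟩ := hg.exists_norm_div_le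
  have hint : ∀ w, Integrable w μ → Integrable (fun x => f₀ x + w x * div g x) μ := fun w hw =>
    hf₀.add (hg.integrable_mul_div hw)
  refine tendsto_iff_dist_tendsto_zero.2 (squeeze_zero (fun _ => dist_nonneg) (fun k => ?_)
    (by simpa only [zero_mul] using hlim.mul_const C))
  rw [dist_eq_norm, ← integral_sub (hint _ (hM k)) (hint _ hm), ← integral_mul_const]
  refine norm_integral_le_of_norm_le (((hM k).sub hm).abs.mul_const C)
    (Eventually.of_forall fun x => ?_)
  rw [add_sub_add_left_eq_sub, ← sub_mul, norm_mul]
  exact mul_le_mul_of_nonneg_left (hC x) (norm_nonneg _)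

lemma integrableOn_abs_mollify_sub (hΩ : MeasurableSet Ω) (hu : IntegrableOn u Ω)
    (φ : ContDiffBump (0 : 𝔼)) :
    IntegrableOn (fun x => |mollify φ (Ω.indicator u) x - u x|) Ω :=
  ((integrable_mollify φ ((integrable_indicator_iff hΩ).2 hu)).integrableOn.sub hu).abs

lemma tendsto_setIntegral_abs_mollify_sub (hΩ : MeasurableSet Ω) (hu : IntegrableOn u Ω) :
    Tendsto (fun k => ∫ x in Ω, |mollify (bump 𝔼 k) (Ω.indicator u) x - u x|) atTop (𝓝 0) := by
  have hui : Integrable (Ω.indicator u) := (integrable_indicator_iff hΩ).2 hu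
  refine squeeze_zero (fun k => integral_nonneg fun x => abs_nonneg _) (fun k => ?_)
    (tendsto_integral_abs_mollify_sub hui)
  calc ∫ x in Ω, |mollify (bump 𝔼 k) (Ω.indicator u) x - u x|
      = ∫ x in Ω, |mollify (bump 𝔼 k) (Ω.indicator u) x - Ω.indicator u x| :=
        setIntegral_congr_fun hΩ fun x hx => by rw [indicator_of_mem hx]
    _ ≤ ∫ x, |mollify (bump 𝔼 k) (Ω.indicator u) x - Ω.indicator u x| :=
        setIntegral_le_integral ((integrable_mollify _ hui).sub hui).abs
          (Eventually.of_forall fun x => abs_nonneg _)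

lemma IsTest.tendsto_setIntegral_add_mul_div_of_abs_sub_le (hΩ : MeasurableSet Ω)
    (hΩv : volume Ω < ∞) (hu : IntegrableOn u Ω) (hv : IntegrableOn v Ω) (hg : IsTest Ω g)
    {f₀ : 𝔼 → ℝ} (hf₀ : IntegrableOn f₀ Ω) {M : ℕ → 𝔼 → ℝ} {m : 𝔼 → ℝ}
    (hM : ∀ k, Continuous (M k)) (hm : IntegrableOn m Ω)
    (hle : ∀ k, ∀ x ∈ Ω, |M k x - m x| ≤ |mollify (bump 𝔼 k) (Ω.indicator u) x - u x|
      + |mollify (bump 𝔼 k) (Ω.indicator v) x - v x| + 1 / ((k : ℝ) + 1)) :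
    Tendsto (fun k => ∫ x in Ω, (f₀ x + M k x * div g x)) atTop
      (𝓝 (∫ x in Ω, (f₀ x + m x * div g x))) := by
  have hAu := fun k => integrableOn_abs_mollify_sub hΩ hu (bump 𝔼 k)
  have hAv := fun k => integrableOn_abs_mollify_sub hΩ hv (bump 𝔼 k)
  have hC : ∀ k : ℕ, IntegrableOn (fun _ : 𝔼 => 1 / ((k : ℝ) + 1)) Ω := fun k =>
    integrableOn_const hΩv.ne
  have hB : ∀ k, IntegrableOn (fun x => |mollify (bump 𝔼 k) (Ω.indicator u) x - u x|
      + |mollify (bump 𝔼 k) (Ω.indicator v) x - v x| + 1 / ((k : ℝ) + 1)) Ω := fun k =>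
    ((hAu k).add (hAv k)).add (hC k)
  have hsub : ∀ k, IntegrableOn (fun x => M k x - m x) Ω := fun k =>
    (hB k).mono' ((hM k).aestronglyMeasurable.sub hm.aestronglyMeasurable)
      (ae_restrict_of_forall_mem hΩ (hle k))
  have hMi : ∀ k, IntegrableOn (M k) Ω := fun k =>
    (Integrable.add (hsub k) hm).congr (Eventually.of_forall fun x => sub_add_cancel _ _)
  refine hg.tendsto_integral_add_mul_div hf₀ hMi hm
    (squeeze_zero (fun k => integral_nonneg fun x => abs_nonneg _) (fun k =>
      setIntegral_mono_on (hsub k).abs (hB k) hΩ (hle k)) ?_)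
  have hsum := ((tendsto_setIntegral_abs_mollify_sub hΩ hu).add
    (tendsto_setIntegral_abs_mollify_sub hΩ hv)).add
    ((tendsto_one_div_add_atTop_nhds_zero_nat (𝕜 := ℝ)).const_mul (volume.real Ω))
  simp only [add_zero, mul_zero] at hsum
  refine hsum.congr fun k => ?_
  have hAuv : IntegrableOn (fun x => |mollify (bump 𝔼 k) (Ω.indicator u) x - u x|
      + |mollify (bump 𝔼 k) (Ω.indicator v) x - v x|) Ω := (hAu k).add (hAv k)
  rw [integral_add hAuv (hC k), integral_add (hAu k) (hAv k), setIntegral_const, smul_eq_mul]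

lemma integral_max_add_integral_min_le (hΩ : IsOpen Ω) (hΩv : volume Ω < ∞)
    (hu : IntegrableOn u Ω) (hv : IntegrableOn v Ω) (hAu : area Ω u ≠ ∞) (hAv : area Ω v ≠ ∞)
    (hg : IsAreaTest Ω g₀ g) (hh : IsAreaTest Ω h₀ h) :
    (∫ x in Ω, (g₀ x + max (u x) (v x) * div g x)) + ∫ x in Ω, (h₀ x + min (u x) (v x) * div h x)
      ≤ (area Ω u).toReal + (area Ω v).toReal := by
  have hδ : ∀ k : ℕ, (0 : ℝ) < 1 / ((k : ℝ) + 1) := fun k => Nat.one_div_pos_of_nat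
  have hsmooth : ∀ {w : 𝔼 → ℝ}, IntegrableOn w Ω → ∀ k,
      ContDiff ℝ 1 (mollify (bump 𝔼 k) (Ω.indicator w)) := fun hw k =>
    contDiff_mollify _ ((integrable_indicator_iff hΩ.measurableSet).2 hw).locallyIntegrable
  have hmax := hg.isTest_snd.tendsto_setIntegral_add_mul_div_of_abs_sub_le hΩ.measurableSet hΩv
    hu hv hg.isTest_fst.integrable.integrableOn
    (fun k => (contDiff_softMax (hδ k) (hsmooth hu k) (hsmooth hv k)).continuous) (hu.sup hv)
    fun k x _ => abs_softMax_sub_max_le (hδ k).le _ _ _ _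
  have hmin := hh.isTest_snd.tendsto_setIntegral_add_mul_div_of_abs_sub_le hΩ.measurableSet hΩv
    hu hv hh.isTest_fst.integrable.integrableOn
    (fun k => (contDiff_softMin (hδ k) (hsmooth hu k) (hsmooth hv k)).continuous) (hu.inf hv)
    fun k x _ => abs_softMin_sub_min_le (hδ k).le _ _ _ _
  obtain ⟨K₁, hK₁, hK₁Ω, hg₁⟩ := hg.exists_isCompact
  obtain ⟨K₂, hK₂, hK₂Ω, hh₂⟩ := hh.exists_isCompact
  refine le_of_tendsto (hmax.add hmin) ?_
  filter_upwards [eventually_closedBall_bump_add_subset (hK₁.union hK₂) hΩ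
    (union_subset hK₁Ω hK₂Ω)] with k hk
  rw [hg.setIntegral_eq, hh.setIntegral_eq]
  exact integral_softMax_mollify_add_integral_softMin_mollify_le hΩ.measurableSet hu hv hAu hAv
    (hg₁.mono subset_union_left) (hh₂.mono subset_union_right) hk (hδ k)

theorem area_max_add_area_min_le (hΩ : IsOpen Ω) (hΩv : volume Ω < ∞) (hu : IntegrableOn u Ω)
    (hv : IntegrableOn v Ω) :
    area Ω (fun x => max (u x) (v x)) + area Ω (fun x => min (u x) (v x))
      ≤ area Ω u + area Ω v := by
  by_cases htop : area Ω u + area Ω v = ∞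
  · exact htop ▸ le_top
  obtain ⟨hAu, hAv⟩ := ENNReal.add_ne_top.1 htop
  rw [← ENNReal.ofReal_toReal htop, ENNReal.toReal_add hAu hAv]
  exact area_add_area_le_ofReal fun _ _ _ _ hg hh =>
    integral_max_add_integral_min_le hΩ hΩv hu hv hAu hAv hg hh

lemma memBV_of_area_lt_top (hu : IntegrableOn u Ω) (hA : area Ω u < ∞) : MemBV Ω u :=
  ⟨hu, totalVariation_le_area.trans_lt hA⟩

lemma MemBV.area_max_add_area_min_lt_top (hΩ : IsOpen Ω) (hΩv : volume Ω < ∞) (hu : MemBV Ω u)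
    (hv : MemBV Ω v) :
    area Ω (fun x => max (u x) (v x)) + area Ω (fun x => min (u x) (v x)) < ∞ :=
  (area_max_add_area_min_le hΩ hΩv hu.1 hv.1).trans_lt
    (ENNReal.add_lt_top.2 ⟨area_lt_top hΩv hu, area_lt_top hΩv hv⟩)

lemma MemBV.max (hΩ : IsOpen Ω) (hΩv : volume Ω < ∞) (hu : MemBV Ω u) (hv : MemBV Ω v) :
    MemBV Ω fun x => max (u x) (v x) :=
  memBV_of_area_lt_top (hu.1.sup hv.1)
    (ENNReal.add_lt_top.1 (hu.area_max_add_area_min_lt_top hΩ hΩv hv)).1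

lemma MemBV.min (hΩ : IsOpen Ω) (hΩv : volume Ω < ∞) (hu : MemBV Ω u) (hv : MemBV Ω v) :
    MemBV Ω fun x => min (u x) (v x) :=
  memBV_of_area_lt_top (hu.1.inf hv.1)
    (ENNReal.add_lt_top.1 (hu.area_max_add_area_min_lt_top hΩ hΩv hv)).2

end Area

/-! ### Directional derivatives of functions of bounded variation -/

section DerivativeBound

open scoped Pointwise Manifold

variable {n : ℕ}

local notation "𝔼" => EuclideanSpace ℝ (Fin n)

variable {K Ω : Set (EuclideanSpace ℝ (Fin n))} {u w f χ : EuclideanSpace ℝ (Fin n) → ℝ}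
  {e : EuclideanSpace ℝ (Fin n)}

lemma exists_isTest_eq_one_on (hK : IsCompact K) (hΩ : IsOpen Ω) (h : K ⊆ Ω) :
    ∃ χ : 𝔼 → ℝ, IsTest Ω χ ∧ (∀ x, χ x ∈ Icc (0 : ℝ) 1) ∧ ∀ x ∈ K, χ x = 1 := by
  obtain ⟨δ, hδ, hδΩ⟩ := hK.exists_cthickening_subset_open hΩ h
  obtain ⟨χ, hχC, hχr, hχs, hχ1⟩ := exists_contMDiff_support_eq_eq_one_iff (n := 1) 𝓘(ℝ, 𝔼)
    (Metric.isOpen_thickening (δ := δ) (E := K)) hK.isClosed (Metric.self_subset_thickening hδ K)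
  have hts : tsupport χ ⊆ Metric.cthickening δ K := by
    rw [tsupport, hχs]
    exact Metric.closure_thickening_subset_cthickening δ K
  exact ⟨χ, ⟨hχC.contDiff, hK.cthickening.of_isClosed_subset (isClosed_tsupport χ) hts,
    hts.trans hδΩ⟩, fun x => hχr (mem_range_self x), fun x hx => (hχ1 x).1 hx⟩

lemma integral_mul_fderiv_mollify_le_totalVariation (hΩ : MeasurableSet Ω) (hu : MemBV Ω u)
    (he : ‖e‖ = 1) (hf : IsTest K f) (hf1 : ∀ x, |f x| ≤ 1) {φ : ContDiffBump (0 : 𝔼)}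
    (hφ : Metric.closedBall 0 φ.rOut + K ⊆ Ω) :
    ∫ x, f x * fderiv ℝ (mollify φ (Ω.indicator u)) x e ≤ (totalVariation Ω u).toReal := by
  have hg : IsTest K fun x => f x • -e :=
    ⟨hf.1.smul contDiff_const, hf.2.1.smul_right (f' := fun _ => -e),
      (tsupport_smul_subset_left f fun _ => -e).trans hf.2.2⟩
  have hg1 : ∀ x, ‖f x • -e‖ ≤ 1 := fun x => by simpa [norm_smul, he] using hf1 x
  have hW : ContDiff ℝ 1 (mollify φ (Ω.indicator u)) :=
    contDiff_mollify φ ((integrable_indicator_iff hΩ).2 hu.1).locallyIntegrable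
  calc ∫ x, f x * fderiv ℝ (mollify φ (Ω.indicator u)) x e
      = ∫ x, mollify φ (Ω.indicator u) x * div (fun x => f x • -e) x := by
        rw [hg.integral_mul_div_eq hW, ← integral_neg]
        simp
    _ = ∫ x in Ω, u x * div (mollify φ fun x => f x • -e) x :=
        hg.integral_mollify_indicator_mul_div φ hΩ hu.1
    _ ≤ (totalVariation Ω u).toReal := (ENNReal.ofReal_le_iff_le_toReal hu.2.ne).1
        (ofReal_integral_le_totalVariation (isTest_mollify hg hφ)
          (norm_mollify_le φ hg.1.continuous.aestronglyMeasurable hg1))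

lemma integral_mul_abs_le_of_softSign (hχ : IsTest K χ) (hχ0 : ∀ x, 0 ≤ χ x)
    (hw : ContDiff ℝ 1 w) {c : ℝ}
    (h : ∀ δ > 0, ∫ x, softSign δ (w x) • χ x * w x ≤ c) : ∫ x, χ x * |w x| ≤ c := by
  have hint : ∀ {a : 𝔼 → ℝ}, Continuous a → Integrable fun x => χ x * a x := fun ha =>
    (hχ.1.continuous.mul ha).integrable_of_hasCompactSupport hχ.2.1.mul_right
  have hle : ∀ δ > 0, ∫ x, χ x * |w x| ≤ c + δ * ∫ x, χ x := fun δ hδ => by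
    have hs : Continuous fun x => w x * softSign δ (w x) :=
      hw.continuous.mul ((contDiff_softSign hδ).comp hw).continuous
    calc ∫ x, χ x * |w x| ≤ ∫ x, (χ x * (w x * softSign δ (w x)) + δ * χ x) := by
          refine integral_mono (hint hw.continuous.abs)
            ((hint hs).add (hχ.integrable.const_mul δ)) fun x => ?_
          nlinarith [mul_le_mul_of_nonneg_left (abs_sub_le_mul_softSign hδ (w x)) (hχ0 x)]
      _ = (∫ x, softSign δ (w x) • χ x * w x) + δ * ∫ x, χ x := by
          rw [integral_add (hint hs) (hχ.integrable.const_mul δ), integral_const_mul]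
          congr 2 with x
          rw [smul_eq_mul]
          ring
      _ ≤ c + δ * ∫ x, χ x := add_le_add_left (h δ hδ) _
  have hlim : Tendsto (fun δ : ℝ => c + δ * ∫ x, χ x) (𝓝[>] 0) (𝓝 c) :=
    ((Continuous.tendsto' (by fun_prop) 0 c (by ring)).mono_left nhdsWithin_le_nhds)
  exact ge_of_tendsto hlim (eventually_mem_nhdsWithin.mono hle)

lemma integral_mul_abs_fderiv_mollify_le_totalVariation (hΩ : MeasurableSet Ω) (hu : MemBV Ω u)
    (he : ‖e‖ = 1) (hχ : IsTest K χ) (hχ01 : ∀ x, χ x ∈ Icc (0 : ℝ) 1)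
    {φ : ContDiffBump (0 : 𝔼)} (hφ : Metric.closedBall 0 φ.rOut + K ⊆ Ω) :
    ∫ x, χ x * |fderiv ℝ (mollify φ (Ω.indicator u)) x e| ≤ (totalVariation Ω u).toReal := by
  have hW : ContDiff ℝ 2 (mollify φ (Ω.indicator u)) :=
    contDiff_mollify φ ((integrable_indicator_iff hΩ).2 hu.1).locallyIntegrable (m := 2)
  have hw : ContDiff ℝ 1 fun x => fderiv ℝ (mollify φ (Ω.indicator u)) x e :=
    (hW.fderiv_right (m := 1) le_rfl).clm_apply contDiff_const
  refine integral_mul_abs_le_of_softSign hχ (fun x => (hχ01 x).1) hw fun δ hδ => ?_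
  refine integral_mul_fderiv_mollify_le_totalVariation hΩ hu he
    (hχ.smul ((contDiff_softSign hδ).comp hw)) (fun x => ?_) hφ
  rw [smul_eq_mul, abs_mul, abs_of_nonneg (hχ01 x).1]
  exact mul_le_one₀ (abs_softSign_le_one δ _) (hχ01 x).1 (hχ01 x).2

lemma eventually_lintegral_fderiv_mollify_le (hΩ : IsOpen Ω) (hu : MemBV Ω u) (he : ‖e‖ = 1)
    (hK : IsCompact K) (hKΩ : K ⊆ Ω) :
    ∀ᶠ k in atTop, ∫⁻ x in K, ‖fderiv ℝ (mollify (bump 𝔼 k) (Ω.indicator u)) x e‖ₑ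
      ≤ totalVariation Ω u := by
  obtain ⟨χ, hχ, hχ01, hχ1⟩ := exists_isTest_eq_one_on hK hΩ hKΩ
  filter_upwards [eventually_closedBall_bump_add_subset hχ.2.1.isCompact hΩ hχ.2.2] with k hk
  have hW : ContDiff ℝ 1 (mollify (bump 𝔼 k) (Ω.indicator u)) :=
    contDiff_mollify _ ((integrable_indicator_iff hΩ.measurableSet).2 hu.1).locallyIntegrable
  have hcont : Continuous fun x => fderiv ℝ (mollify (bump 𝔼 k) (Ω.indicator u)) x e :=
    (hW.continuous_fderiv one_ne_zero).clm_apply continuous_const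
  have hi : Integrable fun x => χ x * |fderiv ℝ (mollify (bump 𝔼 k) (Ω.indicator u)) x e| :=
    (hχ.1.continuous.mul hcont.abs).integrable_of_hasCompactSupport hχ.2.1.mul_right
  calc ∫⁻ x in K, ‖fderiv ℝ (mollify (bump 𝔼 k) (Ω.indicator u)) x e‖ₑ
      = ∫⁻ x in K,
          ENNReal.ofReal (χ x * |fderiv ℝ (mollify (bump 𝔼 k) (Ω.indicator u)) x e|) :=
        setLIntegral_congr_fun hK.measurableSet fun x hx => by
          simp only [hχ1 x hx, one_mul, Real.enorm_eq_ofReal_abs]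
    _ ≤ ∫⁻ x, ENNReal.ofReal (χ x * |fderiv ℝ (mollify (bump 𝔼 k) (Ω.indicator u)) x e|) :=
        setLIntegral_le_lintegral _ _
    _ = ENNReal.ofReal (∫ x, χ x * |fderiv ℝ (mollify (bump 𝔼 k) (Ω.indicator u)) x e|) :=
        (ofReal_integral_eq_lintegral_ofReal hi (Eventually.of_forall fun x =>
          mul_nonneg (hχ01 x).1 (abs_nonneg _))).symm
    _ ≤ totalVariation Ω u := by
        rw [← ENNReal.ofReal_toReal hu.2.ne]
        exact ENNReal.ofReal_le_ofReal (integral_mul_abs_fderiv_mollify_le_totalVariation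
          hΩ.measurableSet hu he ⟨hχ.1, hχ.2.1, subset_rfl⟩ hχ01 hk)

end DerivativeBound

/-! ### Traces from summable dyadic oscillations -/

section Oscillation

/-- The dyadic interval `(ρ 2⁻⁽ʲ⁺¹⁾, ρ 2⁻ʲ]`. -/
def dyadicIoc (ρ : ℝ) (j : ℕ) : Set ℝ := Ioc (ρ / 2 ^ (j + 1)) (ρ / 2 ^ j)

/-- The union of the successive dyadic intervals `dyadicIoc ρ j` and `dyadicIoc ρ (j + 1)`. -/
def dyadicPair (ρ : ℝ) (j : ℕ) : Set ℝ := Ioc (ρ / 2 ^ (j + 2)) (ρ / 2 ^ j)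

/-- The `μ`-essential oscillation of `w` is at most `c`. -/
def EssOscLE {α : Type*} [MeasurableSpace α] (μ : Measure α) (w : α → ℝ) (c : ℝ≥0∞) : Prop :=
  ∀ᵐ t ∂μ, ∀ᵐ s ∂μ, edist (w t) (w s) ≤ c

lemma edist_average_le {α : Type*} [MeasurableSpace α] {μ : Measure α} [IsFiniteMeasure μ]
    [NeZero μ] {w : α → ℝ} (hw : Integrable w μ) {a : ℝ} {c : ℝ≥0∞}
    (h : ∀ᵐ s ∂μ, edist a (w s) ≤ c) : edist a (⨍ s, w s ∂μ) ≤ c := by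
  rw [edist_comm]
  exact (convex_closedEBall a c).average_mem Metric.isClosed_closedEBall
    (h.mono fun s hs => by rwa [Metric.mem_closedEBall, edist_comm]) hw

variable {ρ : ℝ}

lemma div_two_pow_anti (hρ : 0 ≤ ρ) {i j : ℕ} (h : i ≤ j) : ρ / 2 ^ j ≤ ρ / 2 ^ i := by
  gcongr
  norm_num

lemma dyadicIoc_subset_dyadicPair (hρ : 0 ≤ ρ) (j : ℕ) : dyadicIoc ρ j ⊆ dyadicPair ρ j :=
  Ioc_subset_Ioc_left (div_two_pow_anti hρ (by lia))

lemma dyadicIoc_succ_subset_dyadicPair (hρ : 0 ≤ ρ) (j : ℕ) :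
    dyadicIoc ρ (j + 1) ⊆ dyadicPair ρ j :=
  Ioc_subset_Ioc_right (div_two_pow_anti hρ (by lia))

lemma dyadicPair_subset_Ioc (hρ : 0 ≤ ρ) (j : ℕ) : dyadicPair ρ j ⊆ Ioc 0 ρ :=
  Ioc_subset_Ioc (by positivity) (by simpa using div_two_pow_anti hρ (Nat.zero_le j))

lemma dyadicIoc_subset_Ioc (hρ : 0 ≤ ρ) (j : ℕ) : dyadicIoc ρ j ⊆ Ioc 0 ρ :=
  (dyadicIoc_subset_dyadicPair hρ j).trans (dyadicPair_subset_Ioc hρ j)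

lemma Ioc_subset_iUnion_dyadicIoc (hρ : 0 < ρ) (m : ℕ) :
    Ioc 0 (ρ / 2 ^ m) ⊆ ⋃ i, dyadicIoc ρ (i + m) := by
  intro t ht
  have hpos : 0 < ρ / 2 ^ m := by positivity
  obtain ⟨i, hi₁, hi₂⟩ := exists_nat_pow_near_of_lt_one (x := t / (ρ / 2 ^ m)) (y := (1 / 2 : ℝ))
    (div_pos ht.1 hpos) ((div_le_one hpos).2 ht.2) (by norm_num) (by norm_num)
  rw [lt_div_iff₀ hpos] at hi₁
  rw [div_le_iff₀ hpos] at hi₂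
  have hdiv : ∀ k, (1 / 2 : ℝ) ^ k * (ρ / 2 ^ m) = ρ / 2 ^ (k + m) := fun k => by
    rw [pow_add, div_pow, one_pow]
    field_simp
  exact mem_iUnion.2 ⟨i, by rwa [hdiv, add_right_comm] at hi₁, by rwa [hdiv] at hi₂⟩

lemma neZero_restrict_dyadicIoc (hρ : 0 < ρ) (j : ℕ) :
    NeZero (volume.restrict (dyadicIoc ρ j)) := by
  refine ⟨?_⟩
  rw [Ne, Measure.restrict_eq_zero, dyadicIoc, Real.volume_Ioc]
  simp only [ENNReal.ofReal_eq_zero, not_le, sub_pos]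
  gcongr <;> norm_num

section Line

variable {w : ℝ → ℝ}

lemma EssOscLE.ae_edist_dyadicAverage_le (hρ : 0 < ρ) (hw : IntegrableOn w (Ioc 0 ρ)) {i j : ℕ}
    {c : ℝ≥0∞} (h : EssOscLE (volume.restrict (dyadicPair ρ j)) w c)
    (hij : dyadicIoc ρ i ⊆ dyadicPair ρ j) :
    ∀ᵐ t ∂volume.restrict (dyadicPair ρ j), edist (w t) (⨍ s in dyadicIoc ρ i, w s) ≤ c := by
  have := neZero_restrict_dyadicIoc hρ i
  have : IsFiniteMeasure (volume.restrict (dyadicIoc ρ i)) := ⟨by simp [dyadicIoc]⟩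
  filter_upwards [h] with t ht
  exact edist_average_le (hw.mono_set (dyadicIoc_subset_Ioc hρ.le i))
    (ae_restrict_of_ae_restrict_of_subset hij ht)

lemma EssOscLE.edist_dyadicAverage_succ_le (hρ : 0 < ρ) (hw : IntegrableOn w (Ioc 0 ρ)) {j : ℕ}
    {c : ℝ≥0∞} (h : EssOscLE (volume.restrict (dyadicPair ρ j)) w c) :
    edist (⨍ s in dyadicIoc ρ j, w s) (⨍ s in dyadicIoc ρ (j + 1), w s) ≤ c := by
  have := neZero_restrict_dyadicIoc hρ j
  have : IsFiniteMeasure (volume.restrict (dyadicIoc ρ j)) := ⟨by simp [dyadicIoc]⟩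
  rw [edist_comm]
  refine edist_average_le (hw.mono_set (dyadicIoc_subset_Ioc hρ.le j)) ?_
  filter_upwards [ae_restrict_of_ae_restrict_of_subset (dyadicIoc_subset_dyadicPair hρ.le j)
    (h.ae_edist_dyadicAverage_le hρ hw (dyadicIoc_succ_subset_dyadicPair hρ.le j))] with t ht
  rwa [edist_comm]

lemma exists_tendsto_dyadicAverage (hρ : 0 < ρ) (hw : IntegrableOn w (Ioc 0 ρ)) {V : ℕ → ℝ≥0∞}
    (hV : ∑' j, V j ≠ ∞)
    (h : ∀ j, EssOscLE (volume.restrict (dyadicPair ρ j)) w (V j)) :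
    ∃ τ : ℝ, Tendsto (fun j => ⨍ t in dyadicIoc ρ j, w t) atTop (𝓝 τ) ∧
      edist (⨍ t in dyadicIoc ρ 0, w t) τ ≤ ∑' j, V j ∧
      ∀ m, ∀ᵐ t ∂volume.restrict (Ioc 0 (ρ / 2 ^ m)), edist (w t) τ ≤ ∑' i, V (i + m) := by
  have hstep := fun j => (h j).edist_dyadicAverage_succ_le hρ hw
  obtain ⟨τ, hτ⟩ := cauchySeq_tendsto_of_complete (cauchySeq_of_edist_le_of_tsum_ne_top V hstep hV)
  have haτ := edist_le_tsum_of_edist_le_of_tendsto V hstep hτ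
  refine ⟨τ, hτ, by simpa using haτ 0, fun m =>
    ae_restrict_of_ae_restrict_of_subset (Ioc_subset_iUnion_dyadicIoc hρ m)
      ((ae_restrict_iUnion_iff _ _).2 fun i => ?_)⟩
  filter_upwards [ae_restrict_of_ae_restrict_of_subset (dyadicIoc_subset_dyadicPair hρ.le (i + m))
    ((h (i + m)).ae_edist_dyadicAverage_le hρ hw
      (dyadicIoc_succ_subset_dyadicPair hρ.le (i + m)))] with t ht
  calc edist (w t) τ
      ≤ edist (w t) (⨍ s in dyadicIoc ρ (i + m + 1), w s)
        + edist (⨍ s in dyadicIoc ρ (i + m + 1), w s) τ := edist_triangle _ _ _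
    _ ≤ V (i + m) + ∑' k, V (i + m + 1 + k) := by
        simpa only [add_comm _ (i + m + 1)] using add_le_add ht (haτ (i + m + 1))
    _ = ∑' k, V (i + m + k) := by
        rw [tsum_eq_zero_add' (f := fun k => V (i + m + k)) ENNReal.summable]
        simp only [add_zero, add_comm, add_left_comm]
    _ ≤ ∑' k, V (k + m) := by
        simpa only [add_comm, add_left_comm, add_assoc] using
          ENNReal.tsum_comp_le_tsum_of_injective (add_left_injective i) fun k => V (k + m)

end Line

section Cylinder

variable {F : Type*} [NormedAddCommGroup F] [InnerProductSpace ℝ F] [FiniteDimensional ℝ F]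
  [MeasurableSpace F] [BorelSpace F]

lemma tendsto_inv_pow_mul_integral_closedBall {f : F → ℝ} {x : F} {a : ℝ}
    (h : Tendsto (fun r : ℝ => ⨍ y in Metric.closedBall x r, f y) (𝓝[>] 0) (𝓝 a)) :
    Tendsto (fun r : ℝ => (r ^ Module.finrank ℝ F)⁻¹ * ∫ y in Metric.closedBall x r, f y) (𝓝[>] 0)
      (𝓝 (volume.real (Metric.ball (0 : F) 1) * a)) := by
  refine (h.const_mul _).congr' ?_
  filter_upwards [self_mem_nhdsWithin] with r (hr : 0 < r)
  rw [← measure_smul_setAverage _ measure_closedBall_lt_top.ne, smul_eq_mul,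
    Measure.addHaar_real_closedBall _ _ hr.le]
  field_simp

lemma ae_tendsto_inv_pow_mul_integral_closedBall {f : F → ℝ} (hf : LocallyIntegrable f) :
    ∀ᵐ x, Tendsto (fun r : ℝ => (r ^ Module.finrank ℝ F)⁻¹ * ∫ y in Metric.closedBall x r, f y)
      (𝓝[>] 0) (𝓝 (volume.real (Metric.ball (0 : F) 1) * f x)) := by
  filter_upwards [IsUnifLocDoublingMeasure.ae_tendsto_average volume hf 1] with x hx
  refine tendsto_inv_pow_mul_integral_closedBall (hx (fun _ => x) id tendsto_id ?_)
  filter_upwards [self_mem_nhdsWithin] with r (hr : 0 < r)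
  simpa using hr.le

lemma ae_tendsto_inv_pow_mul_integral_abs_sub_closedBall {f : F → ℝ} (hf : LocallyIntegrable f) :
    ∀ᵐ x, Tendsto
      (fun r : ℝ => (r ^ Module.finrank ℝ F)⁻¹ * ∫ y in Metric.closedBall x r, |f y - f x|)
      (𝓝[>] 0) (𝓝 0) := by
  filter_upwards [IsUnifLocDoublingMeasure.ae_tendsto_average_norm_sub volume hf 1] with x hx
  have havg := tendsto_inv_pow_mul_integral_closedBall (hx (fun _ => x) id tendsto_id <| by
    filter_upwards [self_mem_nhdsWithin] with r (hr : 0 < r)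
    simpa using hr.le)
  simpa only [mul_zero, Real.norm_eq_abs] using havg

lemma setIntegral_prod_le_mul_setIntegral {α β : Type*} [MeasurableSpace α] [MeasurableSpace β]
    {μ : Measure α} {ν : Measure β} [SFinite μ] [SFinite ν] {s : Set α} {t : Set β}
    (ht : ν t ≠ ∞) {f : α × β → ℝ} {b : α → ℝ} (hf : IntegrableOn f (s ×ˢ t) (μ.prod ν))
    (hb : IntegrableOn b s μ)
    (h : ∀ᵐ x ∂μ.restrict s, ∀ᵐ y ∂ν.restrict t, f (x, y) ≤ b x) :
    ∫ p in s ×ˢ t, f p ∂μ.prod ν ≤ ν.real t * ∫ x in s, b x ∂μ := by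
  rw [IntegrableOn, ← Measure.prod_restrict] at hf
  rw [← Measure.prod_restrict, integral_prod _ hf, ← integral_const_mul]
  refine integral_mono_ae hf.integral_prod_left (hb.const_mul _) ?_
  filter_upwards [h, hf.prod_right_ae] with x hx hfx
  calc ∫ y in t, f (x, y) ∂ν ≤ ∫ _ in t, b x ∂ν :=
        integral_mono_ae hfx (integrableOn_const ht) hx
    _ = ν.real t * b x := by rw [setIntegral_const, smul_eq_mul]

lemma tendsto_zero_of_eventually_le {α : Type*} {l : Filter α} {f : α → ℝ} {g : ℕ → α → ℝ}
    {b : ℕ → ℝ} (hf : ∀ᶠ x in l, 0 ≤ f x) (hfg : ∀ m, ∀ᶠ x in l, f x ≤ g m x)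
    (hg : ∀ m, Tendsto (g m) l (𝓝 (b m))) (hb : Tendsto b atTop (𝓝 0)) : Tendsto f l (𝓝 0) := by
  refine tendsto_order.2 ⟨fun ε hε => hf.mono fun x hx => hε.trans_le hx, fun ε hε => ?_⟩
  obtain ⟨m, hm⟩ := ((tendsto_order.1 hb).2 ε hε).exists
  filter_upwards [hfg m, (tendsto_order.1 (hg m)).2 ε hm] with x hx hx'
  exact hx.trans_lt hx'

variable {D : Set F} {w : F × ℝ → ℝ} {τ : F → ℝ} {T : ℕ → F → ℝ} {x : F} {L : ℝ}

lemma eventually_integral_cylinder_le (hρ : 0 < ρ) (hx : D ∈ 𝓝 x)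
    (hw : IntegrableOn w (D ×ˢ Ioc 0 ρ)) (hτ : LocallyIntegrable τ)
    (hT : ∀ m, LocallyIntegrable (T m))
    (hbound : ∀ᵐ y ∂volume.restrict D, ∀ m, ∀ᵐ t ∂volume.restrict (Ioc 0 (ρ / 2 ^ m)),
      |w (y, t) - τ y| ≤ T m y) (hL : 0 < L) (m : ℕ) :
    ∀ᶠ r in 𝓝[>] (0 : ℝ), (r ^ (Module.finrank ℝ F + 1))⁻¹ *
        (∫ p in Metric.closedBall x r ×ˢ Ioc 0 (L * r), |w p - τ x|)
      ≤ L * ((r ^ Module.finrank ℝ F)⁻¹ * (∫ y in Metric.closedBall x r, T m y)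
        + (r ^ Module.finrank ℝ F)⁻¹ * ∫ y in Metric.closedBall x r, |τ y - τ x|) := by
  have hsmall : ∀ᶠ r in 𝓝[>] (0 : ℝ), L * r ≤ ρ / 2 ^ m :=
    nhdsWithin_le_nhds ((continuous_const_mul L).tendsto' 0 0 (mul_zero L)
      |>.eventually_le_const (by positivity))
  have hball : ∀ᶠ r in 𝓝[>] (0 : ℝ), Metric.closedBall x r ⊆ D :=
    nhdsWithin_le_nhds (eventually_closedBall_subset hx)
  filter_upwards [hball, hsmall, self_mem_nhdsWithin] with r hBD hrm (hr : 0 < r)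
  have hBfin : volume (Metric.closedBall x r) ≠ ∞ := measure_closedBall_lt_top.ne
  have hTB := (hT m).integrableOn_isCompact (isCompact_closedBall x r)
  have hτB : IntegrableOn (fun y => |τ y - τ x|) (Metric.closedBall x r) :=
    ((hτ.integrableOn_isCompact (isCompact_closedBall x r)).sub (integrableOn_const hBfin)).abs
  have hcyl : IntegrableOn (fun p => |w p - τ x|) (Metric.closedBall x r ×ˢ Ioc 0 (L * r)) := by
    refine ((hw.mono_set (prod_mono hBD (Ioc_subset_Ioc_right (hrm.trans ?_)))).sub
      (integrableOn_const ?_)).abs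
    · simpa using div_two_pow_anti hρ.le (Nat.zero_le m)
    · rw [Measure.volume_eq_prod, Measure.prod_prod]
      exact ENNReal.mul_ne_top hBfin (by simp)
  have hle : ∫ p in Metric.closedBall x r ×ˢ Ioc 0 (L * r), |w p - τ x|
      ≤ volume.real (Ioc 0 (L * r)) * ∫ y in Metric.closedBall x r, (T m y + |τ y - τ x|) := by
    refine setIntegral_prod_le_mul_setIntegral (by simp) hcyl (hTB.add hτB) ?_
    filter_upwards [ae_restrict_of_ae_restrict_of_subset hBD hbound] with y hy
    filter_upwards [ae_restrict_of_ae_restrict_of_subset (Ioc_subset_Ioc_right hrm) (hy m)]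
      with t ht
    linarith [abs_sub_le (w (y, t)) (τ y) (τ x)]
  rw [integral_add hTB hτB, Real.volume_real_Ioc_of_le (by positivity), sub_zero] at hle
  calc _ ≤ (r ^ (Module.finrank ℝ F + 1))⁻¹ * (L * r * ((∫ y in Metric.closedBall x r, T m y)
        + ∫ y in Metric.closedBall x r, |τ y - τ x|)) := by gcongr
    _ = _ := by
      rw [pow_succ]
      field_simp

lemma tendsto_cylinder_of_isLebesguePoint (hρ : 0 < ρ) (hx : D ∈ 𝓝 x)
    (hw : IntegrableOn w (D ×ˢ Ioc 0 ρ)) (hτ : LocallyIntegrable τ)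
    (hT : ∀ m, LocallyIntegrable (T m))
    (hbound : ∀ᵐ y ∂volume.restrict D, ∀ m, ∀ᵐ t ∂volume.restrict (Ioc 0 (ρ / 2 ^ m)),
      |w (y, t) - τ y| ≤ T m y)
    (hτx : Tendsto (fun r : ℝ => (r ^ Module.finrank ℝ F)⁻¹ *
      ∫ y in Metric.closedBall x r, |τ y - τ x|) (𝓝[>] 0) (𝓝 0))
    (hTx : ∀ m, Tendsto (fun r : ℝ => (r ^ Module.finrank ℝ F)⁻¹ *
      ∫ y in Metric.closedBall x r, T m y) (𝓝[>] 0)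
      (𝓝 (volume.real (Metric.ball (0 : F) 1) * T m x)))
    (hT0 : Tendsto (fun m => T m x) atTop (𝓝 0)) (hL : 0 < L) :
    Tendsto (fun r : ℝ => (r ^ (Module.finrank ℝ F + 1))⁻¹ *
      ∫ p in Metric.closedBall x r ×ˢ Ioc 0 (L * r), |w p - τ x|) (𝓝[>] 0) (𝓝 0) := by
  refine tendsto_zero_of_eventually_le ?_
    (eventually_integral_cylinder_le hρ hx hw hτ hT hbound hL)
    (fun m => ((hTx m).add hτx).const_mul L) ?_
  · filter_upwards [self_mem_nhdsWithin] with r (hr : 0 < r)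
    exact mul_nonneg (by positivity) (integral_nonneg fun p => abs_nonneg _)
  · simpa using (hT0.const_mul (volume.real (Metric.ball (0 : F) 1))).const_mul L

variable {V : ℕ → F → ℝ≥0∞}

lemma exists_integrable_edist_le_of_essOscLE (hρ : 0 < ρ) (hD : MeasurableSet D)
    (hw : IntegrableOn w (D ×ˢ Ioc 0 ρ)) (hVm : ∀ j, Measurable (V j))
    (hV : ∫⁻ y in D, ∑' j, V j y ≠ ∞)
    (h : ∀ᵐ y ∂volume.restrict D, ∀ j,
      EssOscLE (volume.restrict (dyadicPair ρ j)) (fun t => w (y, t)) (V j y)) :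
    ∃ τ : F → ℝ, Integrable τ ∧
      ∀ᵐ y ∂volume.restrict D, ∀ m, ∀ᵐ t ∂volume.restrict (Ioc 0 (ρ / 2 ^ m)),
        edist (w (y, t)) (τ y) ≤ ∑' i, V (i + m) y := by
  have hprod : ∀ {s : Set ℝ}, s ⊆ Ioc 0 ρ →
      Integrable w ((volume.restrict D).prod (volume.restrict s)) := fun hs => by
    rw [Measure.prod_restrict, ← Measure.volume_eq_prod]
    exact hw.mono_set (prod_mono subset_rfl hs)
  have hai : ∀ j, IntegrableOn (fun y => ⨍ t in dyadicIoc ρ j, w (y, t)) D := fun j => by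
    simp only [average_eq]
    exact (hprod (dyadicIoc_subset_Ioc hρ.le j)).integral_prod_left.const_mul _
  have hVfin : ∀ᵐ y ∂volume.restrict D, ∑' j, V j y ≠ ∞ :=
    (ae_lt_top (Measurable.tsum hVm) hV).mono fun y hy => hy.ne
  have hlim := (h.and (hVfin.and (hprod subset_rfl).prod_right_ae)).mono fun y hy =>
    exists_tendsto_dyadicAverage hρ hy.2.2 hy.2.1 hy.1
  obtain ⟨τ, hτm, hτ⟩ := exists_stronglyMeasurable_limit_of_tendsto_ae
    (fun j => (hai j).aestronglyMeasurable) (hlim.mono fun y hy => ⟨hy.choose, hy.choose_spec.1⟩)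
  have hspec : ∀ᵐ y ∂volume.restrict D,
      edist (⨍ t in dyadicIoc ρ 0, w (y, t)) (τ y) ≤ ∑' j, V j y ∧
      ∀ m, ∀ᵐ t ∂volume.restrict (Ioc 0 (ρ / 2 ^ m)),
        edist (w (y, t)) (τ y) ≤ ∑' i, V (i + m) y := by
    filter_upwards [hlim, hτ] with y ⟨τ', hτ', hspec⟩ hτy
    rwa [← tendsto_nhds_unique hτ' hτy]
  have hτi : IntegrableOn τ D := by
    refine ((hai 0).abs.add (integrable_toReal_of_lintegral_ne_top
      (Measurable.tsum hVm).aemeasurable hV)).mono' hτm.aestronglyMeasurable ?_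
    filter_upwards [hspec, hVfin] with y hy hVy
    have hdist := ENNReal.toReal_mono hVy hy.1
    rw [← dist_edist, Real.dist_eq, abs_sub_comm] at hdist
    rw [Real.norm_eq_abs]
    exact (abs_sub_abs_le_abs_sub _ _ |>.trans hdist |> sub_le_iff_le_add'.1)
  refine ⟨D.indicator τ, (integrable_indicator_iff hD).2 hτi, ?_⟩
  filter_upwards [hspec, ae_restrict_mem hD] with y hy hyD
  rw [indicator_of_mem hyD]
  exact hy.2

theorem exists_trace_of_essOscLE (hρ : 0 < ρ) (hD : MeasurableSet D)
    (hw : IntegrableOn w (D ×ˢ Ioc 0 ρ)) (hVm : ∀ j, Measurable (V j))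
    (hV : ∑' j, ∫⁻ y in D, V j y ≠ ∞)
    (h : ∀ᵐ y ∂volume.restrict D, ∀ j,
      EssOscLE (volume.restrict (dyadicPair ρ j)) (fun t => w (y, t)) (V j y)) :
    ∃ τ : F → ℝ, Integrable τ ∧
      ∀ᵐ x ∂volume.restrict (interior D), ∀ L > 0,
      Tendsto (fun r : ℝ => (r ^ (Module.finrank ℝ F + 1))⁻¹ *
        ∫ p in Metric.closedBall x r ×ˢ Ioc 0 (L * r), |w p - τ x|) (𝓝[>] 0) (𝓝 0) := by
  have hVsum : ∫⁻ y in D, ∑' j, V j y ≠ ∞ := by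
    rwa [lintegral_tsum fun j => (hVm j).aemeasurable]
  obtain ⟨τ, hτi, hτ⟩ := exists_integrable_edist_le_of_essOscLE hρ hD hw hVm hVsum h
  have hVfin : ∀ᵐ y ∂volume.restrict D, ∑' j, V j y ≠ ∞ :=
    (ae_lt_top (Measurable.tsum hVm) hVsum).mono fun y hy => hy.ne
  have htail : ∀ m y, ∑' i, V (i + m) y ≤ ∑' j, V j y := fun m y =>
    ENNReal.tsum_comp_le_tsum_of_injective (add_left_injective m) fun i => V i y
  let T : ℕ → F → ℝ := fun m => D.indicator fun y => (∑' i, V (i + m) y).toReal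
  have hT : ∀ m, LocallyIntegrable (T m) := fun m =>
    ((integrable_indicator_iff hD).2 (integrable_toReal_of_lintegral_ne_top
      (Measurable.tsum fun i => hVm (i + m)).aemeasurable
      (ne_top_of_le_ne_top hVsum (lintegral_mono (htail m))))).locallyIntegrable
  have hbound : ∀ᵐ y ∂volume.restrict D, ∀ m, ∀ᵐ t ∂volume.restrict (Ioc 0 (ρ / 2 ^ m)),
      |w (y, t) - τ y| ≤ T m y := by
    filter_upwards [hτ, hVfin, ae_restrict_mem hD] with y hy hVy hyD m
    filter_upwards [hy m] with t ht
    simp only [T, indicator_of_mem hyD, ← Real.dist_eq, dist_edist]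
    exact ENNReal.toReal_mono (ne_top_of_le_ne_top hVy (htail m y)) ht
  refine ⟨τ, hτi, ?_⟩
  filter_upwards [ae_restrict_of_ae
      (ae_all_iff.2 fun m => ae_tendsto_inv_pow_mul_integral_closedBall (hT m)),
    ae_restrict_of_ae (ae_tendsto_inv_pow_mul_integral_abs_sub_closedBall hτi.locallyIntegrable),
    ae_restrict_of_ae_restrict_of_subset interior_subset hVfin,
    ae_restrict_mem isOpen_interior.measurableSet] with x hTx hτx hVx hxD L hL
  have hT0 : Tendsto (fun m => T m x) atTop (𝓝 0) := by
    simp only [T, indicator_of_mem (interior_subset hxD)]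
    exact (ENNReal.tendsto_toReal ENNReal.zero_ne_top).comp
      (ENNReal.tendsto_sum_nat_add (fun j => V j x) hVx)
  exact tendsto_cylinder_of_isLebesguePoint hρ (mem_interior_iff_mem_nhds.1 hxD) hw
    hτi.locallyIntegrable hT hbound hτx hTx hT0 hL

end Cylinder

end Oscillation

/-! ### Coordinates over a graph -/

section Graph

variable {E : Type*} [NormedAddCommGroup E] [InnerProductSpace ℝ E] {e : E} {γ : E → ℝ}

/-- Coordinates adapted to the graph of `γ` in direction `e`: the horizontal position and the
height above the graph. Only the values of `γ` on the hyperplane orthogonal to `e` matter. -/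
def graphMap (e : E) (γ : E → ℝ) (p : (ℝ ∙ e)ᗮ × ℝ) : E := (p.1 : E) + (γ p.1 + p.2) • e

/-- The orthogonal projection onto the hyperplane orthogonal to `e`. -/
noncomputable def hproj (e : E) : E →L[ℝ] (ℝ ∙ e)ᗮ := (ℝ ∙ e)ᗮ.orthogonalProjectionOnto

lemma coe_hproj (he : ‖e‖ = 1) (x : E) : (hproj e x : E) = x - inner ℝ e x • e := by
  rw [hproj, Submodule.orthogonalProjectionOnto_orthogonal]
  simp [Submodule.starProjection_unit_singleton ℝ he]

lemma norm_hproj_sub_le (x y : E) : ‖hproj e x - hproj e y‖ ≤ ‖x - y‖ := by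
  rw [← map_sub]
  exact Submodule.norm_orthogonalProjectionOnto_apply_le _ _

lemma inner_graphMap (he : ‖e‖ = 1) (p : (ℝ ∙ e)ᗮ × ℝ) :
    inner ℝ e (graphMap e γ p) = γ p.1 + p.2 := by
  rw [graphMap, inner_add_right, Submodule.mem_orthogonal_singleton_iff_inner_right.1 p.1.2,
    inner_smul_right, real_inner_self_eq_norm_sq, he, one_pow, mul_one, zero_add]

lemma hproj_graphMap (he : ‖e‖ = 1) (p : (ℝ ∙ e)ᗮ × ℝ) : hproj e (graphMap e γ p) = p.1 :=
  Subtype.ext (by rw [coe_hproj he, inner_graphMap he, graphMap, add_sub_cancel_right])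

lemma graphMap_hproj (he : ‖e‖ = 1) (x : E) :
    graphMap e γ (hproj e x, inner ℝ e x - γ (hproj e x)) = x := by
  simp [graphMap, coe_hproj he]

lemma graphMap_injective (he : ‖e‖ = 1) : Function.Injective (graphMap e γ) := by
  intro p q h
  have hfst : p.1 = q.1 := by rw [← hproj_graphMap (γ := γ) he p, h, hproj_graphMap he]
  have hsnd : γ p.1 + p.2 = γ q.1 + q.2 := by rw [← inner_graphMap he, h, inner_graphMap he]
  rw [hfst] at hsnd
  exact Prod.ext hfst (add_left_cancel hsnd)

lemma continuous_graphMap (hγ : Continuous γ) : Continuous (graphMap e γ) := by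
  unfold graphMap
  fun_prop

lemma hasDerivAt_graphMap (y : (ℝ ∙ e)ᗮ) (t : ℝ) :
    HasDerivAt (fun t => graphMap e γ (y, t)) e t := by
  simpa [graphMap] using (((hasDerivAt_id t).const_add (γ y)).smul_const e).const_add (y : E)

variable {U : E → ℝ}

lemma edist_graphMap_le_lintegral_fderiv (hU : ContDiff ℝ 1 U) (y : (ℝ ∙ e)ᗮ) {a b s t : ℝ}
    (hs : s ∈ Ioc a b) (ht : t ∈ Ioc a b) :
    edist (U (graphMap e γ (y, t))) (U (graphMap e γ (y, s)))
      ≤ ∫⁻ r in Ioc a b, ‖fderiv ℝ U (graphMap e γ (y, r)) e‖ₑ := by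
  have hderiv : ∀ r, HasDerivAt (fun r => U (graphMap e γ (y, r)))
      (fderiv ℝ U (graphMap e γ (y, r)) e) r := fun r =>
    (hU.differentiable one_ne_zero _).hasFDerivAt.comp_hasDerivAt r (hasDerivAt_graphMap y r)
  have hcont : Continuous fun r => fderiv ℝ U (graphMap e γ (y, r)) e :=
    ((hU.continuous_fderiv one_ne_zero).comp (continuous_iff_continuousAt.2 fun r =>
      (hasDerivAt_graphMap y r).continuousAt)).clm_apply continuous_const
  rw [edist_eq_enorm_sub, ← intervalIntegral.integral_eq_sub_of_hasDerivAt (fun r _ => hderiv r)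
    (hcont.intervalIntegrable _ _), ← ofReal_norm,
    intervalIntegral.norm_integral_eq_norm_integral_uIoc, ofReal_norm]
  exact (enorm_integral_le_lintegral_enorm _).trans
    (lintegral_mono_set (Ioc_subset_Ioc (le_min hs.1.le ht.1.le) (max_le hs.2 ht.2)))

lemma essOscLE_liminf_lintegral_fderiv {u : E → ℝ} {U : ℕ → E → ℝ} (hU : ∀ k, ContDiff ℝ 1 (U k))
    (y : (ℝ ∙ e)ᗮ) {a b : ℝ}
    (h : ∀ᵐ t ∂volume.restrict (Ioc a b),
      Tendsto (fun k => U k (graphMap e γ (y, t))) atTop (𝓝 (u (graphMap e γ (y, t))))) :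
    EssOscLE (volume.restrict (Ioc a b)) (fun t => u (graphMap e γ (y, t)))
      (liminf (fun k => ∫⁻ t in Ioc a b, ‖fderiv ℝ (U k) (graphMap e γ (y, t)) e‖ₑ) atTop) := by
  filter_upwards [h, ae_restrict_mem measurableSet_Ioc] with t ht htab
  filter_upwards [h, ae_restrict_mem measurableSet_Ioc] with s hs hsab
  rw [← (ht.edist hs).liminf_eq]
  exact liminf_le_liminf (Eventually.of_forall fun k =>
    edist_graphMap_le_lintegral_fderiv (hU k) y hsab htab)

section Dyadic

variable {ρ : ℝ}

lemma sum_lintegral_dyadicIoc (hρ : 0 ≤ ρ) (f : ℝ → ℝ≥0∞) (N : ℕ) :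
    ∑ j ∈ Finset.range N, ∫⁻ t in dyadicIoc ρ j, f t = ∫⁻ t in Ioc (ρ / 2 ^ N) ρ, f t := by
  induction N with
  | zero => simp
  | succ N ih =>
    rw [Finset.sum_range_succ, ih, add_comm, dyadicIoc,
      ← lintegral_union measurableSet_Ioc (Ioc_disjoint_Ioc_of_le le_rfl),
      Ioc_union_Ioc_eq_Ioc (div_two_pow_anti hρ (Nat.le_succ N))]
    simpa using div_two_pow_anti hρ (Nat.zero_le N)

lemma sum_lintegral_dyadicPair_le (hρ : 0 ≤ ρ) (f : ℝ → ℝ≥0∞) (N : ℕ) :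
    ∑ j ∈ Finset.range N, ∫⁻ t in dyadicPair ρ j, f t
      ≤ 2 * ∫⁻ t in Ioc (ρ / 2 ^ (N + 1)) ρ, f t := by
  have hpair : ∀ j, ∫⁻ t in dyadicPair ρ j, f t
      ≤ (∫⁻ t in dyadicIoc ρ (j + 1), f t) + ∫⁻ t in dyadicIoc ρ j, f t := fun j => by
    refine le_trans (le_of_eq ?_) (lintegral_union_le f _ _)
    rw [dyadicIoc, dyadicIoc, dyadicPair,
      Ioc_union_Ioc_eq_Ioc (div_two_pow_anti hρ (by lia)) (div_two_pow_anti hρ (by lia))]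
  refine (Finset.sum_le_sum fun j _ => hpair j).trans ?_
  rw [Finset.sum_add_distrib, two_mul]
  gcongr
  · rw [← sum_lintegral_dyadicIoc hρ, Finset.sum_range_succ' _ N]
    exact le_self_add
  · rw [sum_lintegral_dyadicIoc hρ]
    exact lintegral_mono_set (Ioc_subset_Ioc_left (div_two_pow_anti hρ (Nat.le_succ N)))

end Dyadic

lemma sum_liminf_le_liminf_sum (s : Finset ℕ) (f : ℕ → ℕ → ℝ≥0∞) :
    ∑ i ∈ s, liminf (f i) atTop ≤ liminf (fun k => ∑ i ∈ s, f i k) atTop := by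
  simpa [lintegral_finset] using lintegral_liminf_le (μ := Measure.count.restrict (s : Set ℕ))
    (f := fun k i => f i k) fun k => measurable_of_countable _

variable [FiniteDimensional ℝ E] [MeasurableSpace E] [BorelSpace E]

lemma measurableEmbedding_graphMap (he : ‖e‖ = 1) (hγ : Continuous γ) :
    MeasurableEmbedding (graphMap e γ) :=
  (continuous_graphMap hγ).measurableEmbedding (graphMap_injective he)

lemma measurePreserving_graphMap (he : ‖e‖ = 1) (hγ : Continuous γ) :
    MeasurePreserving (graphMap e γ) := by
  have hshear : MeasurePreserving (fun p : (ℝ ∙ e)ᗮ × ℝ => (p.1, γ p.1 + p.2)) :=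
    (MeasurePreserving.id volume).skew_product (g := fun (y : (ℝ ∙ e)ᗮ) (t : ℝ) => γ y + t)
      (by fun_prop) (Eventually.of_forall fun y => (measurePreserving_add_left volume (γ y)).map_eq)
  have hline : MeasurePreserving (Prod.map (LinearIsometryEquiv.toSpanUnitSingleton (𝕜 := ℝ) e he)
      (id : (ℝ ∙ e)ᗮ → (ℝ ∙ e)ᗮ)) :=
    (LinearIsometryEquiv.measurePreserving _).prod (MeasurePreserving.id volume)
  have hsum := ((ℝ ∙ e).measurePreserving_measurableEquivProd (0 : E)).symm
  rw [InnerProductSpace.euclideanHausdorffMeasure_eq_volume] at hsum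
  convert hsum.comp (hline.comp (Measure.measurePreserving_swap.comp hshear)) using 1
  ext1 p
  simp [graphMap, add_comm]

lemma sum_lintegral_dyadicPair_graphMap_le (he : ‖e‖ = 1) (hγ : Continuous γ) {d : E → ℝ≥0∞}
    (hd : Measurable d) {ρ : ℝ} (hρ : 0 ≤ ρ) (D : Set (ℝ ∙ e)ᗮ) (N : ℕ) :
    ∑ j ∈ Finset.range N, ∫⁻ y in D, ∫⁻ t in dyadicPair ρ j, d (graphMap e γ (y, t))
      ≤ 2 * ∫⁻ x in graphMap e γ '' (D ×ˢ Ioc (ρ / 2 ^ (N + 1)) ρ), d x := by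
  have hdm : Measurable fun p => d (graphMap e γ p) := hd.comp (continuous_graphMap hγ).measurable
  calc ∑ j ∈ Finset.range N, ∫⁻ y in D, ∫⁻ t in dyadicPair ρ j, d (graphMap e γ (y, t))
      = ∫⁻ y in D, ∑ j ∈ Finset.range N, ∫⁻ t in dyadicPair ρ j, d (graphMap e γ (y, t)) :=
        (lintegral_finsetSum _ fun j _ => hdm.lintegral_prod_right').symm
    _ ≤ ∫⁻ y in D, 2 * ∫⁻ t in Ioc (ρ / 2 ^ (N + 1)) ρ, d (graphMap e γ (y, t)) :=
        lintegral_mono fun y => sum_lintegral_dyadicPair_le hρ _ N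
    _ = 2 * ∫⁻ p in D ×ˢ Ioc (ρ / 2 ^ (N + 1)) ρ, d (graphMap e γ p) := by
        rw [lintegral_const_mul _ hdm.lintegral_prod_right', Measure.volume_eq_prod,
          setLIntegral_prod _ hdm.aemeasurable]
    _ = 2 * ∫⁻ x in graphMap e γ '' (D ×ˢ Ioc (ρ / 2 ^ (N + 1)) ρ), d x := by
        rw [(measurePreserving_graphMap he hγ).setLIntegral_comp_emb
          (measurableEmbedding_graphMap he hγ) d]

variable {n : ℕ}

local notation "𝔼" => EuclideanSpace ℝ (Fin n)

variable {Ω : Set (EuclideanSpace ℝ (Fin n))} {u γ : EuclideanSpace ℝ (Fin n) → ℝ}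
  {e : EuclideanSpace ℝ (Fin n)} {D : Set (ℝ ∙ e)ᗮ} {ρ : ℝ}

lemma eventually_sum_lintegral_fderiv_mollify_le (hΩ : IsOpen Ω) (hu : MemBV Ω u) (he : ‖e‖ = 1)
    (hγ : Continuous γ) (hD : IsCompact D) (hρ : 0 < ρ)
    (hsub : ∀ y ∈ D, ∀ t ∈ Ioc 0 ρ, graphMap e γ (y, t) ∈ Ω) (N : ℕ) :
    ∀ᶠ k in atTop, ∑ j ∈ Finset.range N, ∫⁻ y in D, ∫⁻ t in dyadicPair ρ j,
      ‖fderiv ℝ (mollify (bump 𝔼 k) (Ω.indicator u)) (graphMap e γ (y, t)) e‖ₑ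
        ≤ 2 * totalVariation Ω u := by
  have hK : IsCompact (graphMap e γ '' (D ×ˢ Icc (ρ / 2 ^ (N + 1)) ρ)) :=
    (hD.prod isCompact_Icc).image (continuous_graphMap hγ)
  have hKΩ : graphMap e γ '' (D ×ˢ Icc (ρ / 2 ^ (N + 1)) ρ) ⊆ Ω := by
    rintro _ ⟨⟨y, t⟩, ⟨hy, ht⟩, rfl⟩
    exact hsub y hy t ⟨lt_of_lt_of_le (by positivity) ht.1, ht.2⟩
  filter_upwards [eventually_lintegral_fderiv_mollify_le hΩ hu he hK hKΩ] with k hk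
  refine (sum_lintegral_dyadicPair_graphMap_le he hγ
    (measurable_fderiv_apply_const ℝ _ e).enorm hρ.le D N).trans ?_
  gcongr
  exact (lintegral_mono_set (image_mono (prod_mono_right Ioc_subset_Icc_self))).trans hk

theorem MemBV.exists_essOscLE_graphMap (hΩ : IsOpen Ω) (hu : MemBV Ω u) (he : ‖e‖ = 1)
    (hγ : Continuous γ) (hD : IsCompact D) (hρ : 0 < ρ)
    (hsub : ∀ y ∈ D, ∀ t ∈ Ioc 0 ρ, graphMap e γ (y, t) ∈ Ω) :
    ∃ V : ℕ → (ℝ ∙ e)ᗮ → ℝ≥0∞, (∀ j, Measurable (V j)) ∧ ∑' j, ∫⁻ y in D, V j y ≠ ∞ ∧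
      ∀ᵐ y ∂volume.restrict D, ∀ j, EssOscLE (volume.restrict (dyadicPair ρ j))
        (fun t => u (graphMap e γ (y, t))) (V j y) := by
  have hui : Integrable (Ω.indicator u) := (integrable_indicator_iff hΩ.measurableSet).2 hu.1
  let U : ℕ → 𝔼 → ℝ := fun k => mollify (bump 𝔼 k) (Ω.indicator u)
  have hM : ∀ j k, Measurable fun y =>
      ∫⁻ t in dyadicPair ρ j, ‖fderiv ℝ (U k) (graphMap e γ (y, t)) e‖ₑ := fun j k =>
    ((measurable_fderiv_apply_const ℝ (U k) e).enorm.comp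
      (continuous_graphMap hγ).measurable).lintegral_prod_right'
  refine ⟨fun j y => liminf (fun k => ∫⁻ t in dyadicPair ρ j,
    ‖fderiv ℝ (U k) (graphMap e γ (y, t)) e‖ₑ) atTop, fun j => .liminf (hM j), ?_, ?_⟩
  · refine ne_top_of_le_ne_top (ENNReal.mul_ne_top ENNReal.ofNat_ne_top hu.2.ne :
      2 * totalVariation Ω u ≠ ∞) (ENNReal.tsum_le_of_sum_range_le fun N => ?_)
    calc _ ≤ _ := Finset.sum_le_sum fun j _ => lintegral_liminf_le (hM j)
      _ ≤ _ := sum_liminf_le_liminf_sum _ _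
      _ ≤ _ := liminf_le_of_frequently_le'
        (eventually_sum_lintegral_fderiv_mollify_le hΩ hu he hγ hD hρ hsub N).frequently
  · have hlim : ∀ᵐ y : (ℝ ∙ e)ᗮ, ∀ᵐ t : ℝ, Tendsto (fun k => U k (graphMap e γ (y, t))) atTop
        (𝓝 (Ω.indicator u (graphMap e γ (y, t)))) :=
      Measure.ae_ae_of_ae_prod ((measurePreserving_graphMap he hγ).quasiMeasurePreserving.ae
        (ae_tendsto_mollify hui.locallyIntegrable))
    filter_upwards [ae_restrict_of_ae hlim, ae_restrict_mem hD.measurableSet] with y hy hyD j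
    refine essOscLE_liminf_lintegral_fderiv
      (fun k => contDiff_mollify _ hui.locallyIntegrable) y ?_
    filter_upwards [ae_restrict_of_ae hy, ae_restrict_mem measurableSet_Ioc] with t ht htj
    rwa [indicator_of_mem (hsub y hyD t (dyadicPair_subset_Ioc hρ.le j htj))] at ht

end Graph

/-! ### Boundary traces -/

section Chart

variable {E : Type*} [NormedAddCommGroup E] [InnerProductSpace ℝ E] {Ω : Set E} {x₀ e : E} {R : ℝ}
  {K : ℝ≥0} {γ : E → ℝ}

/-- A Lipschitz boundary chart: within the ball of radius `R` around `x₀`, the set `Ω` lies above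
the graph of the `K`-Lipschitz function `γ` in the unit direction `e`. -/
structure IsLipschitzChart (Ω : Set E) (x₀ : E) (R : ℝ) (e : E) (K : ℝ≥0) (γ : E → ℝ) : Prop where
  norm_eq_one : ‖e‖ = 1
  lipschitz : LipschitzWith K γ
  mem_iff : ∀ p, graphMap e γ p ∈ Metric.ball x₀ R → (graphMap e γ p ∈ Ω ↔ 0 < p.2)

lemma finrank_orthogonal_singleton_add_one [FiniteDimensional ℝ E] (he : ‖e‖ = 1) :
    Module.finrank ℝ (ℝ ∙ e)ᗮ + 1 = Module.finrank ℝ E := by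
  rw [← (ℝ ∙ e).finrank_add_finrank_orthogonal,
    finrank_span_singleton (norm_ne_zero_iff.1 (he ▸ one_ne_zero)), add_comm]

lemma volume_ball_inter_ne_top [FiniteDimensional ℝ E] [MeasurableSpace E] [BorelSpace E]
    (x : E) (r : ℝ) (s : Set E) : volume (Metric.ball x r ∩ s) ≠ ∞ :=
  measure_ne_top_of_subset inter_subset_left measure_ball_lt_top.ne

lemma norm_graphMap_sub_le (he : ‖e‖ = 1) (hγ : LipschitzWith K γ) (p q : (ℝ ∙ e)ᗮ × ℝ) :
    ‖graphMap e γ p - graphMap e γ q‖ ≤ (1 + K) * ‖p.1 - q.1‖ + |p.2 - q.2| := by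
  have hsub : graphMap e γ p - graphMap e γ q
      = ((p.1 - q.1 : (ℝ ∙ e)ᗮ) : E) + ((γ p.1 - γ q.1) + (p.2 - q.2)) • e := by
    simp only [graphMap, Submodule.coe_sub]
    module
  have hlip : |γ p.1 - γ q.1| ≤ K * ‖p.1 - q.1‖ := by
    simpa [Real.dist_eq, dist_eq_norm] using hγ.dist_le_mul (p.1 : E) q.1
  rw [hsub]
  refine (norm_add_le _ _).trans ?_
  rw [norm_smul, he, mul_one, ← Submodule.coe_norm, Real.norm_eq_abs]
  linarith [abs_add_le (γ p.1 - γ q.1) (p.2 - q.2)]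

lemma lipschitzWith_graphMap_zero (he : ‖e‖ = 1) (hγ : LipschitzWith K γ) :
    LipschitzWith (1 + K) fun y => graphMap e γ (y, 0) :=
  .of_dist_le_mul fun a b => by
    simpa [dist_eq_norm] using norm_graphMap_sub_le he hγ (a, 0) (b, 0)

namespace IsLipschitzChart

lemma graphMap_mem_closedBall (h : IsLipschitzChart Ω x₀ R e K γ) {y z : (ℝ ∙ e)ᗮ}
    {a t : ℝ} (hy : ‖y - z‖ ≤ a) (ht : |t| ≤ a) :
    graphMap e γ (y, t) ∈ Metric.closedBall (graphMap e γ (z, 0)) ((2 + K) * a) := by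
  rw [mem_closedBall_iff_norm]
  refine (norm_graphMap_sub_le h.norm_eq_one h.lipschitz _ _).trans ?_
  rw [sub_zero]
  calc (1 + K) * ‖y - z‖ + |t| ≤ (1 + K) * a + a := by gcongr
    _ = (2 + K) * a := by ring

lemma preimage_graphMap_ball_inter_subset (h : IsLipschitzChart Ω x₀ R e K γ)
    {y : (ℝ ∙ e)ᗮ} {r : ℝ} (hr : Metric.ball (graphMap e γ (y, 0)) r ⊆ Metric.ball x₀ R) :
    graphMap e γ ⁻¹' (Metric.ball (graphMap e γ (y, 0)) r ∩ Ω)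
      ⊆ Metric.closedBall y r ×ˢ Ioc 0 ((1 + K) * r) := by
  rintro ⟨z, t⟩ ⟨hz, hzΩ⟩
  have ht : 0 < t := (h.mem_iff _ (hr hz)).1 hzΩ
  rw [mem_ball_iff_norm] at hz
  have hzy : ‖z - y‖ ≤ r := by
    simpa only [hproj_graphMap h.norm_eq_one] using
      (norm_hproj_sub_le (e := e) (graphMap e γ (z, t)) (graphMap e γ (y, 0))).trans hz.le
  have hheight : |γ z + t - γ y| ≤ r := by
    simpa [inner_sub_right, inner_graphMap h.norm_eq_one, h.norm_eq_one] using
      (abs_real_inner_le_norm e (graphMap e γ (z, t) - graphMap e γ (y, 0))).trans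
        ((congrArg (· * _) h.norm_eq_one).trans (one_mul _) |>.trans_le hz.le)
  have hlip : |γ z - γ y| ≤ K * r := by
    refine le_trans ?_ (mul_le_mul_of_nonneg_left hzy K.coe_nonneg)
    simpa [Real.dist_eq, dist_eq_norm] using h.lipschitz.dist_le_mul (z : E) y
  refine ⟨mem_closedBall_iff_norm.2 hzy, ht, ?_⟩
  linarith [(abs_le.1 hheight).2, (abs_le.1 hlip).1]

lemma graphMap_hproj_zero (h : IsLipschitzChart Ω x₀ R e K γ) (hΩ : IsOpen Ω) {x : E}
    (hx : x ∈ frontier Ω) (hxR : x ∈ Metric.ball x₀ R) : graphMap e γ (hproj e x, 0) = x := by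
  have hmem : ∀ y ∈ Metric.ball x₀ R, y ∈ Ω ↔ 0 < inner ℝ e y - γ (hproj e y) := fun y hy => by
    simpa only [graphMap_hproj h.norm_eq_one] using
      h.mem_iff (hproj e y, inner ℝ e y - γ (hproj e y)) (by rwa [graphMap_hproj h.norm_eq_one])
  have hle : inner ℝ e x - γ (hproj e x) ≤ 0 :=
    not_lt.1 ((hmem x hxR).not.1 (hΩ.frontier_eq ▸ hx).2)
  have hge : 0 ≤ inner ℝ e x - γ (hproj e x) := by
    by_contra! hlt
    have := h.lipschitz.continuous
    have hopen : IsOpen {y : E | inner ℝ e y - γ (hproj e y) < 0} :=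
      isOpen_lt (by fun_prop) continuous_const
    obtain ⟨y, hy, hyΩ⟩ := mem_closure_iff_nhds.1 (frontier_subset_closure hx) _
      (inter_mem (hopen.mem_nhds hlt) (Metric.isOpen_ball.mem_nhds hxR))
    exact lt_asymm hy.1 ((hmem y hy.2).1 hyΩ)
  conv_rhs => rw [← graphMap_hproj (γ := γ) h.norm_eq_one x, le_antisymm hle hge]

variable [FiniteDimensional ℝ E] [MeasurableSpace E] [BorelSpace E]

lemma measurableEmbedding_graphMap_zero (h : IsLipschitzChart Ω x₀ R e K γ) :
    MeasurableEmbedding fun y => graphMap e γ (y, 0) :=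
  (lipschitzWith_graphMap_zero h.norm_eq_one h.lipschitz).continuous.measurableEmbedding
    fun _ _ hyz => congrArg Prod.fst (graphMap_injective h.norm_eq_one hyz)

lemma exists_mul_pow_le_volume_real (h : IsLipschitzChart Ω x₀ R e K γ) (hΩ : IsOpen Ω)
    (hx₀ : x₀ ∈ frontier Ω) (hR : 0 < R) :
    ∃ c > 0, ∀ᶠ r in 𝓝[>] (0 : ℝ),
      c * r ^ Module.finrank ℝ E ≤ volume.real (Metric.ball x₀ r ∩ Ω) := by
  have hx₀e := h.graphMap_hproj_zero hΩ hx₀ (Metric.mem_ball_self hR)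
  have hd := finrank_orthogonal_singleton_add_one h.norm_eq_one
  let a : ℝ := (2 * (2 + K))⁻¹
  have : 0 < a := by positivity
  let c : ℝ := volume.real (Metric.ball (0 : (ℝ ∙ e)ᗮ) 1)
  have hc : 0 < c := ENNReal.toReal_pos (Metric.measure_ball_pos volume _ one_pos).ne'
    measure_ball_lt_top.ne
  refine ⟨c * a ^ Module.finrank ℝ E, by positivity, ?_⟩
  filter_upwards [self_mem_nhdsWithin, nhdsWithin_le_nhds (Iio_mem_nhds hR)]
    with r (hr : 0 < r) (hrR : r < R)
  have hcyl : Metric.closedBall (hproj e x₀) (a * r) ×ˢ Ioo 0 (a * r)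
      ⊆ graphMap e γ ⁻¹' (Metric.ball x₀ r ∩ Ω) := by
    rintro ⟨y, t⟩ ⟨hy, ht⟩
    have hball := h.graphMap_mem_closedBall (mem_closedBall_iff_norm.1 hy)
      (abs_le.2 ⟨by linarith [ht.1, ht.2], ht.2.le⟩)
    rw [hx₀e] at hball
    have hbr := Metric.closedBall_subset_ball (ε₂ := r) (by simp only [a]; field_simp; linarith)
      hball
    exact ⟨hbr, (h.mem_iff _ (Metric.ball_subset_ball hrR.le hbr)).2 ht.1⟩
  have hpres := (measurePreserving_graphMap h.norm_eq_one h.lipschitz.continuous).measure_preimage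
    (Metric.isOpen_ball.inter hΩ).measurableSet.nullMeasurableSet (s := Metric.ball x₀ r ∩ Ω)
  calc c * a ^ Module.finrank ℝ E * r ^ Module.finrank ℝ E
      = volume.real (Metric.closedBall (hproj e x₀) (a * r) ×ˢ Ioo 0 (a * r)) := by
        rw [Measure.volume_eq_prod, measureReal_prod_prod, Measure.addHaar_real_closedBall _ _
          (by positivity), Real.volume_real_Ioo_of_le (by positivity), ← hd]
        ring
    _ ≤ volume.real (graphMap e γ ⁻¹' (Metric.ball x₀ r ∩ Ω)) :=
        measureReal_mono hcyl (hpres ▸ volume_ball_inter_ne_top x₀ r Ω)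
    _ = volume.real (Metric.ball x₀ r ∩ Ω) := congrArg ENNReal.toReal hpres

end IsLipschitzChart

end Chart

section Trace

variable {n : ℕ}

local notation "𝔼" => EuclideanSpace ℝ (Fin n)

variable {Ω S : Set (EuclideanSpace ℝ (Fin n))} {u v : EuclideanSpace ℝ (Fin n) → ℝ}
  {x x₀ e : EuclideanSpace ℝ (Fin n)} {γ : EuclideanSpace ℝ (Fin n) → ℝ} {K : ℝ≥0} {R : ℝ}

lemma HasLipschitzBoundary.exists_isLipschitzChart (hL : HasLipschitzBoundary Ω)
    (hx : x ∈ frontier Ω) : ∃ R > 0, ∃ e K γ, IsLipschitzChart Ω x R e K γ := by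
  obtain ⟨e, he, K, γ, hγ, hev⟩ := hL x hx
  obtain ⟨R, hR0, hR⟩ := Metric.eventually_nhds_iff_ball.1 hev
  refine ⟨R, hR0, e, K, γ, he, hγ, fun p hp => ?_⟩
  rw [hR _ hp, ← coe_hproj he, hproj_graphMap he, inner_graphMap he]
  exact lt_add_iff_pos_right _

lemma integrableOn_abs_sub_const (hu : IntegrableOn u Ω) (t : ℝ) (x : 𝔼) (r : ℝ) :
    IntegrableOn (fun y => |u y - t|) (Metric.ball x r ∩ Ω) :=
  ((hu.mono_set inter_subset_right).sub
    (integrableOn_const (volume_ball_inter_ne_top x r Ω))).abs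

lemma HasTraceAt.of_abs_sub_le {w : 𝔼 → ℝ} {a b c : ℝ} (ha : HasTraceAt Ω u x a)
    (hb : HasTraceAt Ω v x b) (hu : IntegrableOn u Ω) (hv : IntegrableOn v Ω)
    (h : ∀ y, |w y - c| ≤ |u y - a| + |v y - b|) : HasTraceAt Ω w x c := by
  have hsum := ha.add hb
  rw [add_zero] at hsum
  refine squeeze_zero' ?_ ?_ hsum <;>
    filter_upwards [self_mem_nhdsWithin] with r (hr : 0 < r)
  · exact mul_nonneg (by positivity) (integral_nonneg fun y => abs_nonneg _)
  · have hau := integrableOn_abs_sub_const hu a x r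
    have hbv := integrableOn_abs_sub_const hv b x r
    rw [← mul_add, ← integral_add hau hbv]
    exact mul_le_mul_of_nonneg_left (integral_mono_of_nonneg
      (Eventually.of_forall fun y => abs_nonneg _) (hau.add hbv) (Eventually.of_forall h))
      (by positivity)

lemma HasTraceAt.max {a b : ℝ} (ha : HasTraceAt Ω u x a) (hb : HasTraceAt Ω v x b)
    (hu : IntegrableOn u Ω) (hv : IntegrableOn v Ω) :
    HasTraceAt Ω (fun y => max (u y) (v y)) x (max a b) :=
  ha.of_abs_sub_le hb hu hv fun _ => (abs_max_sub_max_le_max _ _ _ _).trans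
    (max_le_add_of_nonneg (abs_nonneg _) (abs_nonneg _))

lemma HasTraceAt.min {a b : ℝ} (ha : HasTraceAt Ω u x a) (hb : HasTraceAt Ω v x b)
    (hu : IntegrableOn u Ω) (hv : IntegrableOn v Ω) :
    HasTraceAt Ω (fun y => min (u y) (v y)) x (min a b) :=
  ha.of_abs_sub_le hb hu hv fun _ => (abs_min_sub_min_le_max _ _ _ _).trans
    (max_le_add_of_nonneg (abs_nonneg _) (abs_nonneg _))

lemma HasTraceAt.unique_of_le_volume {s t c : ℝ} (hs : HasTraceAt Ω u x s)
    (ht : HasTraceAt Ω u x t) (hu : IntegrableOn u Ω) (hc : 0 < c)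
    (h : ∀ᶠ r in 𝓝[>] (0 : ℝ), c * r ^ n ≤ volume.real (Metric.ball x r ∩ Ω)) : s = t := by
  have hle : |s - t| * c ≤ 0 := by
    refine ge_of_tendsto (by simpa only [add_zero] using hs.add ht) ?_
    filter_upwards [h, self_mem_nhdsWithin] with r hr (hr0 : 0 < r)
    have hus := integrableOn_abs_sub_const hu s x r
    have hut := integrableOn_abs_sub_const hu t x r
    rw [← mul_add, ← integral_add hus hut, inv_mul_eq_div, le_div_iff₀ (by positivity)]
    calc |s - t| * c * r ^ n = c * r ^ n * |s - t| := by ring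
      _ ≤ volume.real (Metric.ball x r ∩ Ω) * |s - t| := by gcongr
      _ = ∫ _ in Metric.ball x r ∩ Ω, |s - t| := by rw [setIntegral_const, smul_eq_mul]
      _ ≤ ∫ y in Metric.ball x r ∩ Ω, (|u y - s| + |u y - t|) :=
          integral_mono (integrableOn_const (volume_ball_inter_ne_top x r Ω)) (hus.add hut)
            fun y => by simpa only [abs_sub_comm (u y) s] using abs_sub_le s (u y) t
  exact sub_eq_zero.1 (abs_nonpos_iff.1 (nonpos_of_mul_nonpos_left hle hc))

lemma HasTraceAt.trace_eq (hL : HasLipschitzBoundary Ω) (hΩ : IsOpen Ω) (hu : IntegrableOn u Ω)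
    (hx : x ∈ frontier Ω) {t : ℝ} (ht : HasTraceAt Ω u x t) : trace Ω u x = t := by
  obtain ⟨R, hR, e, K, γ, h⟩ := hL.exists_isLipschitzChart hx
  obtain ⟨c, hc, hvol⟩ := h.exists_mul_pow_le_volume_real hΩ hx hR
  rw [finrank_euclideanSpace_fin] at hvol
  have hex : ∃ t, HasTraceAt Ω u x t := ⟨t, ht⟩
  rw [trace, dif_pos hex]
  exact hex.choose_spec.unique_of_le_volume ht hu hc hvol

lemma IsLipschitzChart.hasTraceAt_graphMap (h : IsLipschitzChart Ω x₀ R e K γ)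
    (hu : IntegrableOn u Ω) {D : Set (ℝ ∙ e)ᗮ} {ρ : ℝ} (hρ : 0 < ρ)
    (hDΩ : ∀ y ∈ D, ∀ t ∈ Ioc 0 ρ, graphMap e γ (y, t) ∈ Ω) {y : (ℝ ∙ e)ᗮ} (hy : D ∈ 𝓝 y)
    (hyR : graphMap e γ (y, 0) ∈ Metric.ball x₀ R) {τ : ℝ}
    (hτ : Tendsto (fun r : ℝ => (r ^ n)⁻¹ * ∫ p in Metric.closedBall y r ×ˢ Ioc 0 ((1 + K) * r),
      |u (graphMap e γ p) - τ|) (𝓝[>] 0) (𝓝 0)) :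
    HasTraceAt Ω u (graphMap e γ (y, 0)) τ := by
  have hmp := measurePreserving_graphMap h.norm_eq_one h.lipschitz.continuous
  have hemb := measurableEmbedding_graphMap h.norm_eq_one h.lipschitz.continuous
  refine squeeze_zero' ?_ ?_ hτ
  · filter_upwards [self_mem_nhdsWithin] with r (hr : 0 < r)
    exact mul_nonneg (by positivity) (integral_nonneg fun y => abs_nonneg _)
  have hheight : ∀ᶠ r in 𝓝[>] (0 : ℝ), (1 + K) * r ≤ ρ :=
    nhdsWithin_le_nhds ((continuous_const_mul _).tendsto' 0 0 (mul_zero _)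
      |>.eventually_le_const hρ)
  filter_upwards [self_mem_nhdsWithin, hheight,
    nhdsWithin_le_nhds (eventually_closedBall_subset hy),
    nhdsWithin_le_nhds (eventually_closedBall_subset (Metric.isOpen_ball.mem_nhds hyR))]
    with r (hr : 0 < r) hrρ hrD hrR
  rw [← hmp.setIntegral_preimage_emb hemb fun z => |u z - τ|]
  refine mul_le_mul_of_nonneg_left (setIntegral_mono_set ?_
    (Eventually.of_forall fun p => abs_nonneg _) (h.preimage_graphMap_ball_inter_subset
      (Metric.ball_subset_closedBall.trans hrR)).eventuallyLE) (by positivity)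
  refine (IntegrableOn.sub ?_ (integrableOn_const ?_)).abs
  · exact ((hmp.integrableOn_comp_preimage hemb).2 hu).mono_set fun p hp =>
      hDΩ p.1 (hrD hp.1) p.2 ⟨hp.2.1, hp.2.2.trans hrρ⟩
  · rw [Measure.volume_eq_prod, Measure.prod_prod]
    exact ENNReal.mul_ne_top measure_closedBall_lt_top.ne (by simp)

lemma IsLipschitzChart.exists_hasTraceAt_graphMap (h : IsLipschitzChart Ω x₀ R e K γ)
    (hΩ : IsOpen Ω) (hx₀ : x₀ ∈ frontier Ω) (hR : 0 < R) (hu : MemBV Ω u) :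
    ∃ ρ > 0, ∃ τ : (ℝ ∙ e)ᗮ → ℝ, Integrable τ ∧
      ∀ᵐ y ∂volume.restrict (Metric.ball (hproj e x₀) ρ),
        HasTraceAt Ω u (graphMap e γ (y, 0)) (τ y) := by
  have he := h.norm_eq_one
  have hγ := h.lipschitz.continuous
  have hx₀e := h.graphMap_hproj_zero hΩ hx₀ (Metric.mem_ball_self hR)
  obtain ⟨ρ, hρ, hρR⟩ : ∃ ρ > 0, (2 + K) * ρ < R :=
    ⟨R / (2 * (2 + K)), by positivity, by field_simp; linarith⟩
  have hball : ∀ y ∈ Metric.closedBall (hproj e x₀) ρ, ∀ t ∈ Icc 0 ρ,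
      graphMap e γ (y, t) ∈ Metric.ball x₀ R := fun y hy t ht => by
    have := h.graphMap_mem_closedBall (mem_closedBall_iff_norm.1 hy)
      (abs_le.2 ⟨by linarith [ht.1], ht.2⟩)
    rw [hx₀e] at this
    exact Metric.closedBall_subset_ball hρR this
  have hDΩ : ∀ y ∈ Metric.closedBall (hproj e x₀) ρ, ∀ t ∈ Ioc 0 ρ, graphMap e γ (y, t) ∈ Ω :=
    fun y hy t ht => (h.mem_iff _ (hball y hy t ⟨ht.1.le, ht.2⟩)).2 ht.1
  have hw : IntegrableOn (fun p => u (graphMap e γ p))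
      (Metric.closedBall (hproj e x₀) ρ ×ˢ Ioc 0 ρ) :=
    (((measurePreserving_graphMap he hγ).integrableOn_comp_preimage
      (measurableEmbedding_graphMap he hγ)).2 hu.1).mono_set fun p hp => hDΩ p.1 hp.1 p.2 hp.2
  obtain ⟨V, hVm, hVs, hV⟩ :=
    hu.exists_essOscLE_graphMap hΩ he hγ (isCompact_closedBall _ _) hρ hDΩ
  obtain ⟨τ, hτi, hτ⟩ := exists_trace_of_essOscLE hρ measurableSet_closedBall hw hVm hVs hV
  refine ⟨ρ, hρ, τ, hτi, ?_⟩
  filter_upwards [ae_restrict_of_ae_restrict_of_subset Metric.ball_subset_interior_closedBall hτ,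
    ae_restrict_mem measurableSet_ball] with y hy hyD
  have hτy := hy (1 + K) (by positivity)
  rw [finrank_orthogonal_singleton_add_one he, finrank_euclideanSpace_fin] at hτy
  exact h.hasTraceAt_graphMap hu.1 hρ hDΩ
    (mem_of_superset (Metric.isOpen_ball.mem_nhds hyD) Metric.ball_subset_closedBall)
    (hball y (Metric.ball_subset_closedBall hyD) 0 ⟨le_rfl, hρ.le⟩) hτy

lemma euclideanHausdorffMeasure_image_le {X Y : Type*} [MetricSpace X] [MeasurableSpace X]
    [BorelSpace X] [MetricSpace Y] [MeasurableSpace Y] [BorelSpace Y] {f : X → Y} {C : ℝ≥0}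
    (hf : LipschitzWith C f) (d : ℕ) (s : Set X) :
    μHE[d] (f '' s) ≤ (C : ℝ≥0∞) ^ d * μHE[d] s := by
  simp_rw [Measure.euclideanHausdorffMeasure_def, Measure.smul_apply, ENNReal.smul_def,
    smul_eq_mul]
  rw [mul_left_comm]
  gcongr
  simpa only [ENNReal.rpow_natCast] using hf.hausdorffMeasure_image_le d.cast_nonneg s

lemma restrict_euclideanHausdorffMeasure_le_map {F Y : Type*} [NormedAddCommGroup F]
    [InnerProductSpace ℝ F] [FiniteDimensional ℝ F] [MeasurableSpace F] [BorelSpace F]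
    [MetricSpace Y] [MeasurableSpace Y] [BorelSpace Y] {f : F → Y} {C : ℝ≥0}
    (hf : LipschitzWith C f) {D : Set F} {S : Set Y} (hS : S ⊆ f '' D) :
    (μHE[Module.finrank ℝ F] : Measure Y).restrict S
      ≤ ((C : ℝ≥0∞) ^ Module.finrank ℝ F) • (volume.restrict D).map f := by
  refine Measure.le_iff.2 fun A hA => ?_
  have hsub : A ∩ S ⊆ f '' (f ⁻¹' A ∩ D) := by
    rw [image_preimage_inter]
    exact inter_subset_inter_right A hS
  rw [Measure.restrict_apply hA, Measure.smul_apply, Measure.map_apply hf.continuous.measurable hA,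
    Measure.restrict_apply (hf.continuous.measurable hA), smul_eq_mul,
    ← InnerProductSpace.euclideanHausdorffMeasure_eq_volume]
  exact (measure_mono hsub).trans (euclideanHausdorffMeasure_image_le hf _ _)

lemma exists_nhdsWithin_ae_exists_hasTraceAt (hL : HasLipschitzBoundary Ω) (hΩ : IsOpen Ω)
    (hu : MemBV Ω u) (hx₀ : x₀ ∈ frontier Ω) :
    ∃ S ∈ 𝓝[frontier Ω] x₀,
      (∀ᵐ x ∂(μHE[n - 1] : Measure 𝔼).restrict S, ∃ t, HasTraceAt Ω u x t) ∧
      IntegrableOn (trace Ω u) S μHE[n - 1] := by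
  obtain ⟨R, hR, e, K, γ, h⟩ := hL.exists_isLipschitzChart hx₀
  obtain ⟨ρ, hρ, τ, hτi, hτ⟩ := h.exists_hasTraceAt_graphMap hΩ hx₀ hR hu
  have hd : n - 1 = Module.finrank ℝ (ℝ ∙ e)ᗮ := by
    have := finrank_orthogonal_singleton_add_one h.norm_eq_one
    rw [finrank_euclideanSpace_fin] at this
    exact Nat.sub_eq_of_eq_add this.symm
  have hΓ := lipschitzWith_graphMap_zero h.norm_eq_one h.lipschitz
  have hemb := h.measurableEmbedding_graphMap_zero
  let S := frontier Ω ∩ (Metric.ball x₀ R ∩ Metric.ball x₀ ρ)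
  have hSm : MeasurableSet S :=
    isClosed_frontier.measurableSet.inter (measurableSet_ball.inter measurableSet_ball)
  have hS : S ⊆ (fun y => graphMap e γ (y, 0)) '' Metric.ball (hproj e x₀) ρ := fun x hx =>
    ⟨hproj e x, mem_ball_iff_norm.2 ((norm_hproj_sub_le x x₀).trans_lt
      (mem_ball_iff_norm.1 hx.2.2)), h.graphMap_hproj_zero hΩ hx.1 hx.2.1⟩
  have hμ := restrict_euclideanHausdorffMeasure_le_map hΓ hS
  rw [← hd] at hμ
  have hac := (Measure.absolutelyContinuous_of_le hμ).trans Measure.smul_absolutelyContinuous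
  have hae : ∀ᵐ x ∂(μHE[n - 1] : Measure 𝔼).restrict S, HasTraceAt Ω u x (τ (hproj e x)) :=
    hac.ae_le (hemb.ae_map_iff.2 (hτ.mono fun y hy => by rwa [hproj_graphMap h.norm_eq_one]))
  refine ⟨S, inter_mem self_mem_nhdsWithin (nhdsWithin_le_nhds (inter_mem
    (Metric.ball_mem_nhds _ hR) (Metric.ball_mem_nhds _ hρ))), hae.mono fun x hx => ⟨_, hx⟩, ?_⟩
  have hint : Integrable (fun x => τ (hproj e x))
      ((volume.restrict (Metric.ball (hproj e x₀) ρ)).map fun y => graphMap e γ (y, 0)) := by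
    simpa only [hemb.integrable_map_iff, Function.comp_def, hproj_graphMap h.norm_eq_one]
      using hτi.restrict
  refine ((hint.smul_measure (ENNReal.pow_ne_top ENNReal.coe_ne_top)).mono_measure hμ).congr ?_
  filter_upwards [hae, ae_restrict_mem hSm] with x hx hxS
  exact (hx.trace_eq hL hΩ hu.1 hxS.1).symm

theorem ae_exists_hasTraceAt_and_integrableOn_trace (hL : HasLipschitzBoundary Ω) (hΩ : IsOpen Ω)
    (hΩb : Bornology.IsBounded Ω) (hu : MemBV Ω u) :
    (∀ᵐ x ∂(μHE[n - 1] : Measure 𝔼).restrict (frontier Ω), ∃ t, HasTraceAt Ω u x t) ∧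
      IntegrableOn (trace Ω u) (frontier Ω) μHE[n - 1] := by
  have hK : IsCompact (frontier Ω) := Metric.isCompact_of_isClosed_isBounded isClosed_frontier
    (hΩb.closure.subset frontier_subset_closure)
  refine hK.induction_on (p := fun S =>
    (∀ᵐ x ∂(μHE[n - 1] : Measure 𝔼).restrict S, ∃ t, HasTraceAt Ω u x t) ∧
      IntegrableOn (trace Ω u) S μHE[n - 1]) (by simp) ?_ ?_ ?_
  · exact fun s t hst h => ⟨ae_restrict_of_ae_restrict_of_subset hst h.1, h.2.mono_set hst⟩
  · exact fun s t hs ht => ⟨(ae_restrict_union_iff _ _ _).2 ⟨hs.1, ht.1⟩, hs.2.union ht.2⟩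
  · exact fun x hx => exists_nhdsWithin_ae_exists_hasTraceAt hL hΩ hu hx

lemma integral_abs_trace_max_add_min (hL : HasLipschitzBoundary Ω) (hΩ : IsOpen Ω)
    (hΩb : Bornology.IsBounded Ω) (hu : MemBV Ω u) (hv : MemBV Ω v) :
    (∫ x in frontier Ω, |trace Ω (fun x => max (u x) (v x)) x| ∂μHE[n - 1])
      + (∫ x in frontier Ω, |trace Ω (fun x => min (u x) (v x)) x| ∂μHE[n - 1])
    = (∫ x in frontier Ω, |trace Ω u x| ∂μHE[n - 1])
      + ∫ x in frontier Ω, |trace Ω v x| ∂μHE[n - 1] := by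
  have hmax := hu.max hΩ hΩb.measure_lt_top hv
  have hmin := hu.min hΩ hΩb.measure_lt_top hv
  have htrace := fun w hw =>
    ae_exists_hasTraceAt_and_integrableOn_trace (u := w) hL hΩ hΩb hw
  obtain ⟨hue, hui⟩ := htrace u hu
  obtain ⟨hve, hvi⟩ := htrace v hv
  rw [← integral_add (htrace _ hmax).2.abs (htrace _ hmin).2.abs, ← integral_add hui.abs hvi.abs]
  refine integral_congr_ae ?_
  filter_upwards [hue, hve, ae_restrict_mem isClosed_frontier.measurableSet]
    with x ⟨a, ha⟩ ⟨b, hb⟩ hx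
  rw [(ha.max hb hu.1 hv.1).trace_eq hL hΩ hmax.1 hx,
    (ha.min hb hu.1 hv.1).trace_eq hL hΩ hmin.1 hx,
    ha.trace_eq hL hΩ hu.1 hx, hb.trace_eq hL hΩ hv.1 hx]
  exact fn_max_add_fn_min (|·|) a b

end Trace

/-! ### Energies -/

section Energy

variable {n : ℕ}

variable {Ω : Set (EuclideanSpace ℝ (Fin n))} {G Gp Gm : EuclideanSpace ℝ (Fin n) → ℝ → ℝ}
  {u v : EuclideanSpace ℝ (Fin n) → ℝ}

lemma energy_max_add_energy_min_le (hΩ : IsOpen Ω) (hΩb : Bornology.IsBounded Ω)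
    (hL : HasLipschitzBoundary Ω) (hu : MemBV Ω u) (hv : MemBV Ω v)
    (hGu : IntegrableOn (fun x => G x (u x)) Ω) (hGv : IntegrableOn (fun x => G x (v x)) Ω)
    (hGmax : IntegrableOn (fun x => G x (max (u x) (v x))) Ω)
    (hGmin : IntegrableOn (fun x => G x (min (u x) (v x))) Ω) :
    energy Ω G (fun x => max (u x) (v x)) + energy Ω G (fun x => min (u x) (v x))
      ≤ energy Ω G u + energy Ω G v := by
  have hvol := hΩb.measure_lt_top (μ := volume)
  have hfin := fun w hw => (area_lt_top (u := w) hvol hw).ne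
  have harea := ENNReal.toReal_mono (ENNReal.add_ne_top.2 ⟨hfin u hu, hfin v hv⟩)
    (area_max_add_area_min_le hΩ hvol hu.1 hv.1)
  rw [ENNReal.toReal_add (hfin _ (hu.max hΩ hvol hv)) (hfin _ (hu.min hΩ hvol hv)),
    ENNReal.toReal_add (hfin u hu) (hfin v hv)] at harea
  have htrace := integral_abs_trace_max_add_min hL hΩ hΩb hu hv
  have hG : (∫ x in Ω, G x (max (u x) (v x))) + (∫ x in Ω, G x (min (u x) (v x)))
      = (∫ x in Ω, G x (u x)) + ∫ x in Ω, G x (v x) := by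
    simp_rw [← integral_add hGmax hGmin, ← integral_add hGu hGv, fn_max_add_fn_min]
  simp only [energy]
  linarith

lemma energy_sub_energy (hp : IntegrableOn (fun x => Gp x (u x)) Ω)
    (hm : IntegrableOn (fun x => Gm x (u x)) Ω) :
    energy Ω Gp u - energy Ω Gm u = energyGap Ω Gp Gm u := by
  rw [energyGap, integral_sub hp hm, energy, energy, add_sub_add_left_eq_sub]

lemma integrableOn_comp_of_growth {q : ℝ} (hq : 0 < q) {C₁ C₂ : EuclideanSpace ℝ (Fin n) → ℝ}
    (hG : AEStronglyMeasurable (fun x => G x (u x)) (volume.restrict Ω))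
    (hC₁ : MemLp C₁ ∞ (volume.restrict Ω)) (hC₂ : IntegrableOn C₂ Ω)
    (hgrowth : ∀ᵐ x ∂(volume.restrict Ω), ∀ s : ℝ, |G x s| ≤ C₁ x * |s| ^ q + C₂ x)
    (hu : MemLp u (ENNReal.ofReal q) (volume.restrict Ω)) :
    IntegrableOn (fun x => G x (u x)) Ω := by
  have hpow : IntegrableOn (fun x => |u x| ^ q) Ω := by
    simpa [ENNReal.toReal_ofReal hq.le, IntegrableOn] using
      hu.integrable_norm_rpow (ENNReal.ofReal_pos.2 hq).ne' ENNReal.ofReal_ne_top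
  have hprod : IntegrableOn (fun x => C₁ x * |u x| ^ q) Ω :=
    memLp_one_iff_integrable.1 ((memLp_one_iff_integrable.2 hpow).mul hC₁)
  exact (hprod.add hC₂).mono' hG (hgrowth.mono fun x hx => hx (u x))

end Energy

end BVArea

theorem mainTheorem9_general {n : ℕ} {Ω : Set (EuclideanSpace ℝ (Fin n))} (hΩ : IsOpen Ω)
    (hΩb : Bornology.IsBounded Ω) (hΩL : BVArea.HasLipschitzBoundary Ω)
    {Gp Gm : EuclideanSpace ℝ (Fin n) → ℝ → ℝ} {X Kp Km : Set (EuclideanSpace ℝ (Fin n) → ℝ)}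
    (hX : ∀ v ∈ X, BVArea.MemBV Ω v)
    (hGp : ∀ v ∈ X, IntegrableOn (fun x => Gp x (v x)) Ω)
    (hGm : ∀ v ∈ X, IntegrableOn (fun x => Gm x (v x)) Ω)
    (hKp : Kp ⊆ X) (hKm : Km ⊆ X) {up um : EuclideanSpace ℝ (Fin n) → ℝ}
    (hup : BVArea.IsMinimizer (BVArea.energy Ω Gp) Kp up)
    (hum : BVArea.IsMinimizer (BVArea.energy Ω Gm) Km um)
    (hmin : (fun x => min (up x) (um x)) ∈ Km) (hmax : (fun x => max (up x) (um x)) ∈ Kp) :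
    0 ≤ BVArea.energyGap Ω Gp Gm (fun x => max (up x) (um x)) - BVArea.energyGap Ω Gp Gm up := by
  have hupX := hKp hup.1
  have humX := hKm hum.1
  have hmaxX := hKp hmax
  have hsub := BVArea.energy_max_add_energy_min_le hΩ hΩb hΩL (hX _ hupX) (hX _ humX)
    (hGm _ hupX) (hGm _ humX) (hGm _ hmaxX) (hGm _ (hKm hmin))
  have hp_le := hup.2 _ hmax
  have hm_le := hum.2 _ hmin
  rw [← BVArea.energy_sub_energy (hGp _ hmaxX) (hGm _ hmaxX),
    ← BVArea.energy_sub_energy (hGp _ hupX) (hGm _ hupX)]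
  linarith

/-- Comparison principle for minimizers. The assumptions `hGp`, `hGm` say that the integrands
`x ↦ G(x, v(x))` are measurable for the `v` under consideration; they hold for instance for all
Carathéodory functions `G`. -/
theorem mainTheorem9 {n : ℕ} (hn : 1 ≤ n)
    (Ω : Set (EuclideanSpace ℝ (Fin n))) (hΩ : IsOpen Ω) (hΩb : Bornology.IsBounded Ω)
    (hΩL : BVArea.HasLipschitzBoundary Ω)
    (q : ℝ) (hq : 1 ≤ q)
    (Gp Gm : EuclideanSpace ℝ (Fin n) → ℝ → ℝ)
    (hGp : ∀ v ∈ BVArea.LqBV q Ω,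
      AEStronglyMeasurable (fun x => Gp x (v x)) (volume.restrict Ω))
    (hGm : ∀ v ∈ BVArea.LqBV q Ω,
      AEStronglyMeasurable (fun x => Gm x (v x)) (volume.restrict Ω))
    (C₁ C₂ : EuclideanSpace ℝ (Fin n) → ℝ)
    (hC₁ : MemLp C₁ ∞ (volume.restrict Ω)) (hC₂ : IntegrableOn C₂ Ω)
    (hGp_growth : ∀ᵐ x ∂(volume.restrict Ω), ∀ s : ℝ, |Gp x s| ≤ C₁ x * |s| ^ q + C₂ x)
    (hGm_growth : ∀ᵐ x ∂(volume.restrict Ω), ∀ s : ℝ, |Gm x s| ≤ C₁ x * |s| ^ q + C₂ x)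
    (Kp Km : Set (EuclideanSpace ℝ (Fin n) → ℝ))
    (hKp : Kp ⊆ BVArea.LqBV q Ω) (hKm : Km ⊆ BVArea.LqBV q Ω)
    (up um : EuclideanSpace ℝ (Fin n) → ℝ)
    (hup : BVArea.IsMinimizer (BVArea.energy Ω Gp) Kp up)
    (hum : BVArea.IsMinimizer (BVArea.energy Ω Gm) Km um)
    (hmin : (fun x => min (up x) (um x)) ∈ Km)
    (hmax : (fun x => max (up x) (um x)) ∈ Kp) :
    0 ≤ BVArea.energyGap Ω Gp Gm (fun x => max (up x) (um x)) -
      BVArea.energyGap Ω Gp Gm up :=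
  mainTheorem9_general hΩ hΩb hΩL (fun _ hv => hv.2)
    (fun v hv => BVArea.integrableOn_comp_of_growth (by positivity) (hGp v hv) hC₁ hC₂ hGp_growth
      hv.1)
    (fun v hv => BVArea.integrableOn_comp_of_growth (by positivity) (hGm v hv) hC₁ hC₂ hGm_growth
      hv.1)
    hKp hKm hup hum hmin hmax
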